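/- Let $n \ge 1$ be an integer and let $A = \mathbb{C}[x,y]/(xy)$. The symmetric group $S_n$ acts on the $n$-fold tensor power $A^{\otimes n}$ (over $\mathbb{C}$) by permuting the tensor factors. For $P \in A^{\otimes n}$ let $P(0,\dots,0)$ denote the value of $P$ at the point where all coordinates $x$ and $y$ of all factors are $0$, i.e. the image of $P$ under the algebra homomorphism $a_1 \otimes \cdots \otimes a_n \mapsto a_1(0)\cdots a_n(0)$, where $a(0)$ is the value of $a \in A$ at $x = y = 0$. Put $$(A^{\otimes n})^{S_n}_+ = \{P \in A^{\otimes n} : \sigma P = P \text{ for all } \sigma \in S_n,\ P(0,\dots,0) = 0\},$$ and let the symmetric coinvariant algebra $A^{\otimes n}_{S_n}$ be the quotient of $A^{\otimes n}$ by the ideal generated by $(A^{\otimes n})^{S_n}_+$, with the induced action of $S_n$. Then there is an isomorphism of $S_n$-modules $$A^{\otimes n}_{S_n} \simeq \mathbb{C}[S_n] \oplus (n-1)\operatorname{Ind}_{S_2}^{S_n} L_{(1,1)},$$ where $\mathbb{C}[S_n]$ is the regular representation, $L_{(1,1)}$ is the one-dimensional sign representation of $S_2$, $S_2 \subset S_n$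 (for $n \ge 2$) is the subgroup of permutations of the first two indices, $\operatorname{Ind}_{S_2}^{S_n} L = \mathbb{C}[S_n] \otimes_{\mathbb{C}[S_2]} L$, and $(n-1)V$ denotes the direct sum of $n-1$ copies of $V$. For $n = 1$ the second summand is zero. -/

import Mathlib

open scoped TensorProduct

noncomputable section

namespace SymCoinv

/-- The representation of a group `G`, acting on a commutative `ℂ`-algebra `B` by algebra
endomorphisms, on the quotient of `B` by an invariant ideal `J`. -/
def quotRep {G B : Type} [Group G] [CommRing B] [Algebra ℂ B] (φ : G →* (B →ₐ[ℂ] B))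
    (J : Ideal B) (hJ : ∀ g, J ≤ J.comap (φ g)) : Representation ℂ G (B ⧸ J) where
  toFun g := (Ideal.quotientMapₐ J (φ g) (hJ g)).toLinearMap
  map_one' := by
    refine LinearMap.ext fun x => ?_
    obtain ⟨P, rfl⟩ := Ideal.Quotient.mk_surjective x
    change Ideal.Quotient.mk J (φ 1 P) = Ideal.Quotient.mk J P
    rw [map_one]
    rfl
  map_mul' g h := by
    refine LinearMap.ext fun x => ?_
    obtain ⟨P, rfl⟩ := Ideal.Quotient.mk_surjective x
    change Ideal.Quotient.mk J (φ (g * h) P) = Ideal.Quotient.mk J (φ g (φ h P))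
    rw [map_mul]
    rfl

section General

variable (A : Type) [CommRing A] [Algebra ℂ A]

/-- The `n`-th tensor power `A^{⊗ n}` over `ℂ` of a commutative `ℂ`-algebra `A`. -/
abbrev TPow (n : ℕ) : Type := ⨂[ℂ] _ : Fin n, A

/-- The algebra endomorphism of `A^{⊗ n}` given by a permutation `σ` of the tensor factors; it
moves the factor in position `i` to position `σ i`. -/
def permAlgHom (n : ℕ) (σ : Equiv.Perm (Fin n)) : TPow A n →ₐ[ℂ] TPow A n :=
  AlgHom.ofLinearMap (PiTensorProduct.reindex ℂ (fun _ => A) σ).toLinearMap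
    (PiTensorProduct.reindex_tprod σ _) (by
      refine (LinearMap.map_mul_iff _).mpr ?_
      ext f g
      change PiTensorProduct.reindex ℂ (fun _ => A) σ
          (PiTensorProduct.tprod ℂ f * PiTensorProduct.tprod ℂ g) =
        PiTensorProduct.reindex ℂ (fun _ => A) σ (PiTensorProduct.tprod ℂ f) *
          PiTensorProduct.reindex ℂ (fun _ => A) σ (PiTensorProduct.tprod ℂ g)
      simp only [PiTensorProduct.tprod_mul_tprod, PiTensorProduct.reindex_tprod]
      rfl)

@[simp]
lemma permAlgHom_tprod (n : ℕ) (σ : Equiv.Perm (Fin n)) (f : Fin n → A) :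
    permAlgHom A n σ (PiTensorProduct.tprod ℂ f) =
      PiTensorProduct.tprod ℂ fun i => f (σ.symm i) :=
  PiTensorProduct.reindex_tprod σ f

/-- The action of `S_n` on `A^{⊗ n}` by permutation of the tensor factors. -/
def permAction (n : ℕ) : Equiv.Perm (Fin n) →* (TPow A n →ₐ[ℂ] TPow A n) where
  toFun := permAlgHom A n
  map_one' := by
    apply AlgHom.toLinearMap_injective
    ext f
    exact permAlgHom_tprod A n 1 f
  map_mul' σ τ := by
    apply AlgHom.toLinearMap_injective
    ext f
    change permAlgHom A n (σ * τ) (PiTensorProduct.tprod ℂ f) =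
      permAlgHom A n σ (permAlgHom A n τ (PiTensorProduct.tprod ℂ f))
    simp only [permAlgHom_tprod]
    rfl

variable {A}
variable (ε : A →ₐ[ℂ] ℂ)

/-- If `ε : A → ℂ` is the evaluation `P ↦ P(0)` at a base point `0`, this is the evaluation of
elements of `A^{⊗ n}` at `(0, …, 0)`, namely `a₁ ⊗ ⋯ ⊗ aₙ ↦ a₁(0) ⋯ aₙ(0)`. -/
def evalOrigin (n : ℕ) : TPow A n →ₐ[ℂ] ℂ :=
  PiTensorProduct.liftAlgHom
    ((MultilinearMap.mkPiAlgebra ℂ (Fin n) ℂ).compLinearMap fun _ => ε.toLinearMap)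
    (by simp) (by intro x y; simp [Finset.prod_mul_distrib])

/-- The set `(A^{⊗ n})^{S_n}_+` of symmetric elements of `A^{⊗ n}` vanishing at `(0, …, 0)`. -/
def symmPlus (n : ℕ) : Set (TPow A n) :=
  {P | (∀ σ : Equiv.Perm (Fin n), permAction A n σ P = P) ∧ evalOrigin ε n P = 0}

/-- The ideal of `A^{⊗ n}` generated by `(A^{⊗ n})^{S_n}_+`. -/
def coinvIdeal (n : ℕ) : Ideal (TPow A n) := Ideal.span (symmPlus ε n)

lemma coinvIdeal_le_comap (n : ℕ) (σ : Equiv.Perm (Fin n)) :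
    coinvIdeal ε n ≤ (coinvIdeal ε n).comap (permAction A n σ) := by
  refine Ideal.span_le.mpr fun P hP => ?_
  change permAction A n σ P ∈ coinvIdeal ε n
  rw [hP.1 σ]
  exact Ideal.subset_span hP

/-- The symmetric coinvariant algebra `A^{⊗ n}_{S_n}`, the quotient of `A^{⊗ n}` by the ideal
generated by `(A^{⊗ n})^{S_n}_+`. -/
abbrev CoinvAlg (n : ℕ) : Type := TPow A n ⧸ coinvIdeal ε n

/-- The action of `S_n` on `A^{⊗ n}_{S_n}` induced by the permutation of the tensor factors. -/
def coinvRep (n : ℕ) : Representation ℂ (Equiv.Perm (Fin n)) (CoinvAlg ε n) :=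
  quotRep (permAction A n) (coinvIdeal ε n) (coinvIdeal_le_comap ε n)

end General

/-- The ring `ℂ[x, y] / (x y)`, with `x = X 0` and `y = X 1`. -/
abbrev DoublePoint : Type :=
  MvPolynomial (Fin 2) ℂ ⧸
    (Ideal.span {MvPolynomial.X 0 * MvPolynomial.X 1} : Ideal (MvPolynomial (Fin 2) ℂ))

/-- Evaluation `P ↦ P(0)` of elements of `ℂ[x, y] / (x y)` at the double point `x = y = 0`. -/
def evalZero : DoublePoint →ₐ[ℂ] ℂ :=
  Ideal.Quotient.liftₐ _ (MvPolynomial.aeval (fun _ : Fin 2 => (0 : ℂ))) (by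
    intro a ha
    have h : (Ideal.span {MvPolynomial.X 0 * MvPolynomial.X 1} :
        Ideal (MvPolynomial (Fin 2) ℂ)) ≤
        RingHom.ker (MvPolynomial.aeval (fun _ : Fin 2 => (0 : ℂ))) := by
      rw [Ideal.span_le, Set.singleton_subset_iff]
      simp [RingHom.mem_ker]
    exact h ha)

/-- The sign representation `L_{(1,1)}` of `S_2`. -/
def signRep : Representation ℂ (Equiv.Perm (Fin 2)) ℂ where
  toFun σ := ((Equiv.Perm.sign σ : ℤ) : ℂ) • LinearMap.id
  map_one' := by ext; simp
  map_mul' σ τ := by ext; simp [mul_comm]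

/-- For `2 ≤ n`, the inclusion `S_2 → S_n` as the permutations of the first two indices. -/
def inclS2 {n : ℕ} (h : 2 ≤ n) : Equiv.Perm (Fin 2) →* Equiv.Perm (Fin n) :=
  Equiv.Perm.viaEmbeddingHom (Fin.castLEEmb h)

/-- The induced representation `Ind_{S_2}^{S_n} L_{(1,1)}`, for `2 ≤ n`. -/
def indSign {n : ℕ} (h : 2 ≤ n) :
    Representation ℂ (Equiv.Perm (Fin n)) (Representation.IndV (inclS2 h) signRep) :=
  Representation.ind (inclS2 h) signRep

/-- As soon as there is one of the `n - 1` copies, `2 ≤ n` holds, so that `S_2` embeds in `S_n`. -/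
lemma two_le_of_fin {n : ℕ} (i : Fin (n - 1)) : 2 ≤ n := by
  have := i.2
  omega

/-- The direct sum `(n - 1) Ind_{S_2}^{S_n} L_{(1,1)}` of `n - 1` copies of the induced
representation; it is the zero representation for `n = 1`. -/
def copiesIndSign (n : ℕ) : Representation ℂ (Equiv.Perm (Fin n))
    (DirectSum (Fin (n - 1)) fun i =>
      Representation.IndV (inclS2 (two_le_of_fin i)) signRep) :=
  Representation.directSum fun i => indSign (two_le_of_fin i)

end SymCoinv

end

/-! The coinvariant algebra is `PolyXY n ⧸ symIdeal n`, where `symIdeal n` is generated by the `x_i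
y_i` and the symmetric polynomials without constant term. The representation on the right has
dimension n! + (n - 1) n!/2 = (n + 1)!/2. It therefore suffices to bound the dimension of the
quotient by (n + 1)!/2 and to map it equivariantly onto that representation.

Upper bound (`two_mul_colength_le`). Filter by the squarefree products y_S, larger S first and, for
equal size, smaller sum of indices first. The layer of S is a quotient by a colon ideal that
contains y_i for i ∉ S and x_i for i ∈ S, so only the x outside S and the y inside S survive, each
family with vanishing power sums. Multiplying the elementary symmetric polynomial e_{|S|}(y) by
suitable monomials gives further relations (`mul_prod_mem_colonIdeal`), which bound the layer by a
sum over pairs j < c with j ∈ S and c ∉ S. Summing over S gives n! + (n - 1) n!/2.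

Surjection. A functional ℓ vanishing on `symIdeal n` gives the equivariant map sending f to the
function w ↦ ℓ(w⁻¹ f) on S_n; if ℓ changes sign under the first transposition, these functions lie
in a copy of the induced sign representation. What is needed is n functionals, all but the first
anti-invariant, whose translates are jointly as independent as possible
(`exists_isCoinvariantDualBasis`). They are built by induction, by degenerating evaluations at
points away from the origin: `symIdeal` consists of leading forms of the ideal of such points, and
composing an evaluation with an equivariant degree-preserving section along `symIdeal` produces a
functional vanishing on `symIdeal` without losing rank (`exists_apply_section_eq`).

For n + 1 points, the n old functionals are induced by moving one point to x = 1, y = 0. They can be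
made to vanish on `facetIdeal`, generated by the products of all but one of the y_i. One new
functional is the derivative at points on the y-axis with coordinates 0, 0, 1, 2, …, along a
direction separating the two coinciding points; its translates are already independent on
`facetIdeal`. Hence the two families are independent of each other. That the second degeneration can
be carried out inside `facetIdeal` rests on a dimension count, `mem_sup_degLT_of_mem_pointIdeal`. -/

open scoped TensorProduct

noncomputable section

namespace SymCoinv

open Finset

/-! ### Families with vanishing power sums -/

section PowerSums

variable {Q ι : Type*} [CommRing Q] [Algebra ℂ Q]

/-- If all power sums of positive degree of a finite family vanish, so do its elementary symmetric
functions of positive degree. -/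
lemma esymm_eq_zero_of_psum_eq_zero (P : Finset ι) (z : ι → Q)
    (h : ∀ k, 1 ≤ k → ∑ i ∈ P, z i ^ k = 0) (m : ℕ) (hm : 1 ≤ m) :
    (P.val.map z).esymm m = 0 := by
  classical
  have hmap : (univ : Finset P).val.map (fun i : P => z i.1) = P.val.map z := by
    rw [Finset.univ_eq_attach, Finset.attach_val]
    exact Multiset.attach_map_val' P.val z
  have hN := congrArg (MvPolynomial.aeval (R := ℂ) fun i : P => z i.1)
    (MvPolynomial.mul_esymm_eq_sum P ℂ m)
  rw [map_mul, MvPolynomial.aeval_esymm_eq_multiset_esymm, hmap, map_mul, map_sum,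
    Finset.sum_eq_zero, mul_zero, map_natCast] at hN
  · have hu : IsUnit ((m : ℕ) : Q) := by
      have : IsUnit ((m : ℕ) : ℂ) := by
        rw [isUnit_iff_ne_zero]; exact_mod_cast (by omega)
      simpa using this.map (algebraMap ℂ Q)
    exact hu.mul_right_eq_zero.mp hN
  · rintro ⟨a, b⟩ hab
    rw [Finset.mem_filter, Finset.HasAntidiagonal.mem_antidiagonal] at hab
    have hb : 1 ≤ b := by have := hab.1; have := hab.2; simp only at *; omega
    have : MvPolynomial.aeval (R := ℂ) (fun i : P => z i) (MvPolynomial.psum P ℂ b) = 0 := by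
      rw [MvPolynomial.psum, map_sum]
      simp only [map_pow, MvPolynomial.aeval_X]
      rw [← h b hb, ← Finset.sum_coe_sort P (fun i => z i ^ b)]
    rw [map_mul, this, mul_zero]

lemma sum_powersetCard_prod_eq_zero (P : Finset ι) (z : ι → Q)
    (h : ∀ k, 1 ≤ k → ∑ i ∈ P, z i ^ k = 0) (m : ℕ) (hm : 1 ≤ m) :
    ∑ t ∈ P.powersetCard m, ∏ i ∈ t, z i = 0 := by
  rw [← Finset.esymm_map_val]
  exact esymm_eq_zero_of_psum_eq_zero P z h m hm

open Polynomial in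
-- By Vieta, the lower coefficients are elementary symmetric functions of positive degree, which
-- vanish.
lemma prod_X_sub_C_eq_X_pow (P : Finset ι) (z : ι → Q)
    (h : ∀ k, 1 ≤ k → ∑ i ∈ P, z i ^ k = 0) :
    ∏ i ∈ P, ((X : Q[X]) - C (z i)) = X ^ P.card := by
  have := Multiset.prod_X_sub_X_eq_sum_esymm (P.val.map z)
  rw [Multiset.map_map] at this
  change (P.val.map fun i => X - C (z i)).prod = _ at this
  rw [Finset.prod_map_val] at this
  rw [this, Multiset.card_map, Finset.sum_range_succ', Finset.sum_eq_zero]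
  · simp [Multiset.esymm]
  · intro j _
    rw [esymm_eq_zero_of_psum_eq_zero P z h (j + 1) (by omega)]
    simp

lemma pow_card_eq_zero (P : Finset ι) (z : ι → Q)
    (h : ∀ k, 1 ≤ k → ∑ i ∈ P, z i ^ k = 0) {u : ι} (hu : u ∈ P) : z u ^ P.card = 0 := by
  have := congrArg (Polynomial.eval (z u)) (prod_X_sub_C_eq_X_pow P z h)
  rw [Polynomial.eval_prod, Finset.prod_eq_zero hu (by simp)] at this
  simpa using this.symm

open Polynomial in
/-- If all power sums of positive degree vanish, a power of one element of the family is, up to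
sign, the product of the other ones. -/
lemma pow_card_pred_eq [DecidableEq ι] (P : Finset ι) (z : ι → Q)
    (h : ∀ k, 1 ≤ k → ∑ i ∈ P, z i ^ k = 0) {u : ι} (hu : u ∈ P) :
    z u ^ (P.card - 1) = (-1) ^ (P.card - 1) * ∏ i ∈ P.erase u, z i := by
  have h1 := prod_X_sub_C_eq_X_pow P z h
  have h2 : (X - C (z u)) * ∏ i ∈ P.erase u, ((X : Q[X]) - C (z i)) =
      (X - C (z u)) * ∑ i ∈ range P.card, X ^ i * C (z u) ^ (P.card - 1 - i) := by
    rw [Finset.mul_prod_erase P (fun i => (X : Q[X]) - C (z i)) hu, h1,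
      (Commute.all (X : Q[X]) (C (z u))).mul_geom_sum₂, ← C_pow,
      pow_card_eq_zero P z h hu, C_0, sub_zero]
  -- The monic factor X - z_u can be cancelled although `Q` may have zero divisors; the claim is the
  -- constant term of what remains.
  have h3 := (monic_X_sub_C (z u)).isRegular.left h2
  have h4 := congrArg (Polynomial.eval 0) h3
  have hpos : 0 < P.card := Finset.card_pos.mpr ⟨u, hu⟩
  rw [Polynomial.eval_prod, Polynomial.eval_finsetSum,
    Finset.sum_eq_single_of_mem 0 (by simpa using hpos)
      (by intro b _ hb; simp [hb])] at h4
  simp only [eval_sub, eval_X, eval_C, zero_sub, pow_zero, one_mul, eval_pow, Nat.sub_zero] at h4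
  rw [← h4, Finset.prod_neg, Finset.card_erase_of_mem hu]

end PowerSums

section Ideals

variable {B ι : Type*} [CommRing B]

lemma mem_of_mk_eq {L : Ideal B} {b : B} (h : Ideal.Quotient.mk L b = 0) : b ∈ L :=
  Ideal.Quotient.eq_zero_iff_mem.mp h

/-- Modulo the ideal `L`, the family `z` is supported on `P` and has vanishing power sums. -/
structure PsumMem (L : Ideal B) (z : ι → B) (P : Finset ι) : Prop where
  mem_of_notMem : ∀ i, i ∉ P → z i ∈ L
  psum_mem : ∀ k, 1 ≤ k → ∑ i ∈ P, z i ^ k ∈ L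

lemma PsumMem.mono {L L' : Ideal B} {z : ι → B} {P : Finset ι} (h : PsumMem L z P) (hL : L ≤ L') :
    PsumMem L' z P :=
  ⟨fun i hi => hL (h.1 i hi), fun k hk => hL (h.2 k hk)⟩

lemma PsumMem.mk_psum {L : Ideal B} {z : ι → B} {P : Finset ι} (h : PsumMem L z P) (k : ℕ)
    (hk : 1 ≤ k) : ∑ i ∈ P, Ideal.Quotient.mk L (z i) ^ k = 0 := by
  have := Ideal.Quotient.eq_zero_iff_mem.mpr (h.2 k hk)
  simpa using this

lemma PsumMem.erase [DecidableEq ι] {L : Ideal B} {z : ι → B} {P : Finset ι} (h : PsumMem L z P)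
    {u : ι} (hu : u ∈ P) (hz : z u ∈ L) : PsumMem L z (P.erase u) := by
  refine ⟨fun i hi => ?_, fun k hk => ?_⟩
  · by_cases hiu : i = u
    · exact hiu ▸ hz
    · exact h.1 i fun hP => hi (Finset.mem_erase.mpr ⟨hiu, hP⟩)
  · have := h.2 k hk
    rw [← Finset.add_sum_erase P _ hu] at this
    exact (L.add_mem_iff_right (L.pow_mem_of_mem hz k (by omega))).mp this

end Ideals

/-! ### Colength bounds by filtration -/

section Colength

variable {B : Type*} [CommRing B] [Algebra ℂ B]

/-- The dimension over `ℂ`, possibly infinite, of the quotient of an algebra by an ideal. -/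
def colength (L : Ideal B) : ℕ∞ := Module.length ℂ (B ⧸ L)

lemma colength_antitone {L L' : Ideal B} (h : L ≤ L') : colength L' ≤ colength L :=
  Module.length_le_of_surjective (Ideal.Quotient.factorₐ ℂ h).toLinearMap
    (Ideal.Quotient.factor_surjective h)

@[simp]
lemma colength_top : colength (⊤ : Ideal B) = 0 := by
  rw [colength, Module.length_eq_zero_iff]
  exact Ideal.Quotient.subsingleton_iff.mpr rfl

/-- Multiplication by `a` maps `B ⧸ J` onto (L + (a))/L, the kernel of `B ⧸ L` → `B ⧸ (L + (a))`. -/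
lemma colength_le_add (L J : Ideal B) (a : B) (h : ∀ j ∈ J, a * j ∈ L) :
    colength L ≤ colength (L ⊔ Ideal.span {a}) + colength J := by
  let g := (Ideal.Quotient.factorₐ ℂ (le_sup_left : L ≤ L ⊔ Ideal.span {a})).toLinearMap
  have hg : Function.Surjective g :=
    Ideal.Quotient.factor_surjective (le_sup_left : L ≤ L ⊔ Ideal.span {a})
  let f : B →ₗ[ℂ] LinearMap.ker g :=
    ((Ideal.Quotient.mkₐ ℂ L).toLinearMap ∘ₗ LinearMap.mulLeft ℂ a).codRestrict _ (by
      intro b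
      change Ideal.Quotient.mk (L ⊔ Ideal.span {a}) (a * b) = 0
      rw [Ideal.Quotient.eq_zero_iff_mem]
      exact Ideal.mul_mem_right _ _ (Ideal.mem_sup_right (Ideal.mem_span_singleton_self a)))
  have hf : Function.Surjective f := by
    rintro ⟨q, hq⟩
    obtain ⟨b, rfl⟩ := Ideal.Quotient.mk_surjective q
    change Ideal.Quotient.mk (L ⊔ Ideal.span {a}) b = 0 at hq
    rw [Ideal.Quotient.eq_zero_iff_mem] at hq
    obtain ⟨l, hl, c, hc, rfl⟩ := Submodule.mem_sup.mp hq
    obtain ⟨d, rfl⟩ := Ideal.mem_span_singleton'.mp hc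
    refine ⟨d, Subtype.ext ?_⟩
    change Ideal.Quotient.mk L (a * d) = Ideal.Quotient.mk L (l + d * a)
    rw [map_add, Ideal.Quotient.eq_zero_iff_mem.mpr hl, zero_add, mul_comm]
  have hJ : J.restrictScalars ℂ ≤ LinearMap.ker f := by
    intro j hj
    rw [LinearMap.mem_ker]
    exact Subtype.ext (Ideal.Quotient.eq_zero_iff_mem.mpr (h j hj))
  have key := Module.length_eq_add_of_exact (LinearMap.ker g).subtype g
    (Submodule.subtype_injective _) hg (LinearMap.exact_subtype_ker_map g)
  have h2 : Module.length ℂ (LinearMap.ker g) ≤ colength J := by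
    refine Module.length_le_of_surjective (R := ℂ) (M := B ⧸ J)
      ((J.restrictScalars ℂ).liftQ f hJ) fun q => ?_
    obtain ⟨b, hb⟩ := hf q
    exact ⟨Submodule.Quotient.mk b, hb⟩
  rw [colength, key, add_comm]
  exact add_le_add le_rfl h2

/-- Filter by the powers of `a`: each of the p layers is a cyclic module annihilated by L and `a`.
-/
lemma colength_le_mul (L : Ideal B) (a : B) (p : ℕ) (h : a ^ p ∈ L) :
    colength L ≤ p * colength (L ⊔ Ideal.span {a}) := by
  have key : ∀ j : ℕ, colength (L ⊔ Ideal.span {a ^ j}) ≤ j * colength (L ⊔ Ideal.span {a}) := by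
    intro j
    induction j with
    | zero => simp
    | succ j ih =>
      refine (colength_le_add _ (L ⊔ Ideal.span {a}) (a ^ j) fun b hb => ?_).trans ?_
      · obtain ⟨l, hl, c, hc, rfl⟩ := Submodule.mem_sup.mp hb
        obtain ⟨d, rfl⟩ := Ideal.mem_span_singleton'.mp hc
        rw [mul_add]
        refine add_mem (Ideal.mem_sup_left (L.mul_mem_left _ hl)) (Ideal.mem_sup_right ?_)
        exact Ideal.mem_span_singleton'.mpr ⟨d, by ring⟩
      · rw [Nat.cast_succ, add_mul, one_mul]
        refine add_le_add ((colength_antitone ?_).trans ih) le_rfl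
        exact sup_le (le_sup_left.trans le_sup_left) le_sup_right
  have := key p
  rwa [sup_eq_left.mpr ((Ideal.span_singleton_le_iff_mem _).mpr h)] at this

variable {ι : Type*}

/-- Modulo L a chosen z_u has nilpotency order at most |P|, and killing it leaves |P| - 1 elements
with vanishing power sums. This is the classical bound for coinvariants of a symmetric group. -/
lemma PsumMem.colength_le [DecidableEq ι] {z : ι → B} (P : Finset ι) : ∀ {L : Ideal B},
    PsumMem L z P →
    colength L ≤ (P.card.factorial : ℕ) * colength (L ⊔ Ideal.span (Set.range z)) := by
  induction P using Finset.induction_on with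
  | empty =>
    intro L h
    have : L ⊔ Ideal.span (Set.range z) = L := by
      rw [sup_eq_left, Ideal.span_le]
      rintro _ ⟨i, rfl⟩
      exact h.1 i (by simp)
    rw [this]; simp
  | insert u P hu ih =>
    intro L h
    have hp : z u ^ (P.card + 1) ∈ L := by
      apply mem_of_mk_eq
      rw [map_pow, ← Finset.card_insert_of_notMem hu]
      exact pow_card_eq_zero (insert u P) _ h.mk_psum (Finset.mem_insert_self u P)
    refine (colength_le_mul L (z u) _ hp).trans ?_
    have h' : PsumMem (L ⊔ Ideal.span {z u}) z P := by
      have := (h.mono (le_sup_left : L ≤ L ⊔ Ideal.span {z u})).erase (Finset.mem_insert_self u P)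
        (Ideal.mem_sup_right (Ideal.mem_span_singleton_self _))
      rwa [Finset.erase_insert hu] at this
    rw [Finset.card_insert_of_notMem hu, Nat.factorial_succ, Nat.cast_mul, mul_assoc]
    refine mul_le_mul_right ((ih h').trans (mul_le_mul_right (colength_antitone ?_) _)) _
    exact sup_le_sup le_sup_left le_rfl

/-- Strip the factors one at a time. Killing z_u leaves |P| - 1 elements, hence the factor (|P| -
1)!; the ideal generated by z_u is annihilated by the product of the remaining factors, to which
induction applies. -/
lemma PsumMem.colength_le_of_prod_mem [DecidableEq ι] {z : ι → B} {P : Finset ι} (U : Finset ι) :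
    ∀ {L : Ideal B}, U ⊆ P → PsumMem L z P → ∏ i ∈ U, z i ∈ L →
    colength L ≤ (U.card * (P.card - 1).factorial : ℕ) *
      colength (L ⊔ Ideal.span (Set.range z)) := by
  induction U using Finset.induction_on with
  | empty =>
    intro L _ _ h
    rw [Finset.prod_empty, ← Ideal.eq_top_iff_one] at h
    simp [h]
  | insert u U hu ih =>
    intro L hUP h hU
    rw [Finset.prod_insert hu] at hU
    have huP := hUP (Finset.mem_insert_self u U)
    refine (colength_le_add L (L ⊔ Ideal.span {∏ i ∈ U, z i}) (z u) fun b hb => ?_).trans ?_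
    · obtain ⟨l, hl, c, hc, rfl⟩ := Submodule.mem_sup.mp hb
      obtain ⟨d, rfl⟩ := Ideal.mem_span_singleton'.mp hc
      rw [mul_add, mul_left_comm]
      exact add_mem (L.mul_mem_left _ hl) (L.mul_mem_left _ hU)
    · rw [Finset.card_insert_of_notMem hu, add_mul, one_mul, Nat.cast_add, add_mul, add_comm]
      refine add_le_add ?_ ?_
      · refine (ih (fun i hi => hUP (Finset.mem_insert_of_mem hi)) (h.mono le_sup_left)
          (Ideal.mem_sup_right (Ideal.mem_span_singleton_self _))).trans
          (mul_le_mul_right (colength_antitone ?_) _)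
        exact sup_le_sup le_sup_left le_rfl
      · have := ((h.mono (le_sup_left : L ≤ L ⊔ Ideal.span {z u})).erase huP
          (Ideal.mem_sup_right (Ideal.mem_span_singleton_self _))).colength_le
        rw [Finset.card_erase_of_mem huP] at this
        exact this.trans (mul_le_mul_right (colength_antitone (sup_le_sup le_sup_left le_rfl)) _)

end Colength

/-! ### Layers indexed by chains and colon ideals -/

section Chain

variable {B ι : Type*} [CommRing B] [Algebra ℂ B]

/-- The products of x over upper segments of P form a chain of ideals from 1 down to the full
product, which is in L. The step at c is annihilated by x_c and by the product of the y_j with j <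
c, so its x-part contributes (|P| - 1)! and its y-part is bounded by
`PsumMem.colength_le_of_prod_mem`. -/
lemma PsumMem.colength_le_of_chain [LinearOrder ι] {x y : ι → B}
    (hgen : colength (Ideal.span (Set.range x) ⊔ Ideal.span (Set.range y)) ≤ 1)
    {L : Ideal B} {P Q : Finset ι} (hx : PsumMem L x P) (hy : PsumMem L y Q)
    (hP : ∏ i ∈ P, x i ∈ L)
    (hchain : ∀ c ∈ P, (∏ i ∈ P with c < i, x i) * ∏ j ∈ Q with j < c, y j ∈ L) :
    colength L ≤
      (∑ c ∈ P, (P.card - 1).factorial * (#{j ∈ Q | j < c} * (Q.card - 1).factorial) : ℕ) := by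
  have key : ∀ A ⊆ P,
      (∀ c ∈ A, (∏ i ∈ A with c < i, x i) * ∏ j ∈ Q with j < c, y j ∈ L) →
      colength (L ⊔ Ideal.span {∏ i ∈ A, x i}) ≤
      (∑ c ∈ A, (P.card - 1).factorial * (#{j ∈ Q | j < c} * (Q.card - 1).factorial) : ℕ) := by
    intro A
    induction A using Finset.induction_on_min with
    | empty => intro _ _; simp [Ideal.span_singleton_one]
    | insert a A ha ih =>
      intro hA hc
      have haA : a ∉ A := fun h => lt_irrefl _ (ha a h)
      have haP : a ∈ P := hA (Finset.mem_insert_self a A)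
      have hf : ∀ c ∈ A, {i ∈ insert a A | c < i} = {i ∈ A | c < i} := by
        intro c hcA
        rw [Finset.filter_insert, if_neg (not_lt.mpr (ha c hcA).le)]
      have hfa : {i ∈ insert a A | a < i} = A := by
        rw [Finset.filter_insert, if_neg (lt_irrefl _), Finset.filter_true_of_mem ha]
      have hYa := hc a (Finset.mem_insert_self a A)
      rw [hfa] at hYa
      rw [Finset.sum_insert haA, Finset.prod_insert haA]
      -- As `a` lies below all of `A`, the chain hypothesis at `a` says that ∏_A x times the
      -- y-product over j < a is in L; thus J annihilates ∏_A x modulo L and ∏_{insert a A} x.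
      let J := (L ⊔ Ideal.span {x a}) ⊔ Ideal.span {∏ j ∈ Q with j < a, y j}
      refine (colength_le_add _ J (∏ i ∈ A, x i) fun b hb => ?_).trans ?_
      · obtain ⟨l, hl, c, hc, rfl⟩ := Submodule.mem_sup.mp hb
        obtain ⟨l', hl', d, hd, rfl⟩ := Submodule.mem_sup.mp hl
        obtain ⟨c, rfl⟩ := Ideal.mem_span_singleton'.mp hc
        obtain ⟨d, rfl⟩ := Ideal.mem_span_singleton'.mp hd
        rw [mul_add, mul_add]
        refine add_mem (add_mem (Ideal.mem_sup_left (L.mul_mem_left _ hl'))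
          (Ideal.mem_sup_right ?_)) (Ideal.mem_sup_left ?_)
        · exact Ideal.mem_span_singleton'.mpr ⟨d, by ring⟩
        · rw [mul_left_comm]; exact L.mul_mem_left _ hYa
      · rw [Nat.cast_add, add_comm]
        refine add_le_add ?_ ?_
        · have hLJ : L ≤ J := le_sup_left.trans le_sup_left
          have hxa : x a ∈ J :=
            Ideal.mem_sup_left (Ideal.mem_sup_right (Ideal.mem_span_singleton_self _))
          have h1 := ((hx.mono hLJ).erase haP hxa).colength_le
          have h2 := ((hy.mono (hLJ.trans
            (le_sup_left : J ≤ J ⊔ Ideal.span (Set.range x))))).colength_le_of_prod_mem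
              {j ∈ Q | j < a} (Finset.filter_subset _ _)
              (Ideal.mem_sup_left (Ideal.mem_sup_right (Ideal.mem_span_singleton_self _)))
          rw [Finset.card_erase_of_mem haP] at h1
          refine h1.trans ?_
          rw [Nat.cast_mul]
          refine mul_le_mul_right (h2.trans ?_) _
          refine (mul_le_mul_right ((colength_antitone ?_).trans hgen) _).trans (mul_one _).le
          exact sup_le_sup le_sup_right le_rfl
        · refine (colength_antitone ?_).trans (ih (fun i hi => hA (Finset.mem_insert_of_mem hi))
            fun c hcA => hf c hcA ▸ hc c (Finset.mem_insert_of_mem hcA))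
          exact sup_le_sup le_sup_left le_rfl
  have := key P subset_rfl hchain
  rwa [sup_eq_left.mpr ((Ideal.span_singleton_le_iff_mem _).mpr hP)] at this

/-- The colon ideal `(L : a)`. -/
def colonIdeal (L : Ideal B) (a : B) : Ideal B := Submodule.comap (LinearMap.mulLeft B a) L

omit [Algebra ℂ B] in
@[simp]
lemma mem_colonIdeal {L : Ideal B} {a b : B} : b ∈ colonIdeal L a ↔ a * b ∈ L := Iff.rfl

omit [Algebra ℂ B] in
lemma le_colonIdeal (L : Ideal B) (a : B) : L ≤ colonIdeal L a :=
  fun _ hb => L.mul_mem_left a hb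

/-- The `a T` are adjoined to I in order of decreasing weight, `s` being the set of those still to
come. When `a S` is adjoined, every element of strictly larger weight is already present, so the
layer is a quotient by an ideal containing the colon ideal shown. -/
lemma colength_le_sum_colonIdeal {κ W : Type*} [DecidableEq κ] [LinearOrder W] (I : Ideal B)
    (a : κ → B) (wt : κ → W) (s : Finset κ) :
    colength (I ⊔ Ideal.span (a '' {T | T ∉ s})) ≤
      ∑ S ∈ s, colength (colonIdeal (I ⊔ Ideal.span (a '' {T | wt S < wt T})) (a S)) +
        colength (I ⊔ Ideal.span (Set.range a)) := by
  induction s using Finset.induction_on_max_value wt with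
  | empty => simp
  | insert S s hS hmax ih =>
    rw [Finset.sum_insert hS, add_assoc]
    refine (colength_le_add _
      (colonIdeal (I ⊔ Ideal.span (a '' {T | wt S < wt T})) (a S)) (a S) fun b hb => ?_).trans ?_
    · have hT : {T | wt S < wt T} ⊆ {T | T ∉ insert S s} := ?_
      · exact (sup_le_sup_left (Ideal.span_mono (Set.image_mono hT)) I :) hb
      intro T hT hTs
      rcases Finset.mem_insert.mp hTs with rfl | hTs
      · exact lt_irrefl _ hT
      · exact (hmax T hTs).not_gt hT
    · rw [add_comm]
      refine add_le_add le_rfl ((colength_antitone ?_).trans ih)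
      refine sup_le (le_sup_left.trans le_sup_left) (Ideal.span_le.mpr ?_)
      rintro _ ⟨T, hT, rfl⟩
      by_cases hTS : T = S
      · subst hTS; exact Ideal.mem_sup_right (Ideal.mem_span_singleton_self _)
      · refine Ideal.mem_sup_left (Ideal.mem_sup_right (Ideal.subset_span ⟨T, ?_, rfl⟩))
        intro h
        exact (Finset.mem_insert.mp h).elim hTS hT

end Chain

/-! ### The count (n - 1) n!/2 -/

section Count

open Nat in
-- The sets of each fixed size contribute #V! in total, and there are #V + 1 sizes.
lemma sum_powerset_factorial_mul_factorial {κ : Type*} (V : Finset κ) :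
    ∑ S ∈ V.powerset, (#S)! * (#V - #S)! = (#V + 1)! := by
  rw [Finset.sum_powerset_apply_card fun m => m ! * (#V - m)!]
  rw [Finset.sum_congr rfl (g := fun _ => (#V)!), Finset.sum_const, Finset.card_range,
    smul_eq_mul, Nat.factorial_succ]
  intro m hm
  rw [smul_eq_mul, ← mul_assoc]
  exact Nat.choose_mul_factorial_mul_factorial (by simpa [Nat.lt_succ_iff] using hm)

open Nat in
-- Removing j from S leaves an arbitrary subset of the n - 2 indices other than j and c.
lemma sum_separating_factorial {n : ℕ} {j c : Fin n} (hjc : j ≠ c) :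
    ∑ S : Finset (Fin n) with j ∈ S ∧ c ∉ S, (#Sᶜ - 1)! * (#S - 1)! = (n - 1)! := by
  have hV : #((univ.erase c).erase j) = n - 2 := by
    rw [Finset.card_erase_of_mem (by simp [hjc]), Finset.card_erase_of_mem (by simp)]
    simp; omega
  have hn : 2 ≤ n := by
    have := j.2; have := c.2; have : (j : ℕ) ≠ c := fun h => hjc (Fin.ext h); omega
  have := sum_powerset_factorial_mul_factorial ((univ.erase c).erase j)
  rw [hV, show n - 2 + 1 = n - 1 by omega] at this
  rw [← this]
  refine Finset.sum_nbij' (fun S => S.erase j) (fun S => insert j S) ?_ ?_ ?_ ?_ ?_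
  · intro S hS
    rw [Finset.mem_filter] at hS
    rw [Finset.mem_powerset]
    intro i hi
    rw [Finset.mem_erase] at hi
    simp only [Finset.mem_erase, Finset.mem_univ, and_true]
    exact ⟨hi.1, fun h => hS.2.2 (h ▸ hi.2)⟩
  · intro S hS
    rw [Finset.mem_powerset] at hS
    simp only [Finset.mem_filter, Finset.mem_univ, true_and, Finset.mem_insert_self,
      Finset.mem_insert, not_or]
    exact ⟨hjc.symm, fun h => by simpa using hS h⟩
  · intro S hS
    rw [Finset.mem_filter] at hS
    exact Finset.insert_erase hS.2.1
  · intro S hS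
    rw [Finset.mem_powerset] at hS
    exact Finset.erase_insert fun h => by simpa using hS h
  · intro S hS
    rw [Finset.mem_filter] at hS
    rw [Finset.card_erase_of_mem hS.2.1, Finset.card_compl, Fintype.card_fin, mul_comm]
    congr 2
    have := Finset.card_pos.mpr ⟨j, hS.2.1⟩
    omega

lemma card_pairs_lt (n : ℕ) : 2 * ∑ c : Fin n, #{j : Fin n | j < c} = n * (n - 1) := by
  have : ∀ c : Fin n, #{j : Fin n | j < c} = c := fun c => by
    rw [← Fin.card_Iio]; congr 1; ext; simp
  rw [Finset.sum_congr rfl fun c _ => this c, Fin.sum_univ_eq_sum_range (fun i => i), mul_comm,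
    Finset.sum_range_id_mul_two]

open Nat in
-- Exchanging the sums, each of the n(n - 1)/2 pairs j < c contributes (n - 1)!, summed over the S
-- that contain j but not c.
lemma two_mul_sum_layers (n : ℕ) :
    2 * ∑ S : Finset (Fin n), ∑ c ∈ Sᶜ, (#Sᶜ - 1)! * (#{j ∈ S | j < c} * (#S - 1)!) =
      (n - 1) * n ! := by
  have h1 : ∀ S : Finset (Fin n),
      ∑ c ∈ Sᶜ, (#Sᶜ - 1)! * (#{j ∈ S | j < c} * (#S - 1)!) =
      ∑ c : Fin n, ∑ j : Fin n with j < c,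
        if j ∈ S ∧ c ∉ S then (#Sᶜ - 1)! * (#S - 1)! else 0 := by
    intro S
    rw [← Finset.sum_filter_add_sum_filter_not univ (fun c => c ∉ S)]
    rw [Finset.sum_eq_zero (s := {c | ¬ c ∉ S}), add_zero]
    · refine Finset.sum_congr (by ext; simp) fun c hc => ?_
      have hc : c ∉ S := by simpa using hc
      rw [← Finset.sum_filter, Finset.sum_const, smul_eq_mul, Finset.filter_filter]
      rw [show ({a | a < c ∧ a ∈ S ∧ c ∉ S} : Finset (Fin n)) = {j ∈ S | j < c} by
        ext; simp [hc, and_comm]]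
      ring
    · intro c hc
      refine Finset.sum_eq_zero fun j _ => if_neg ?_
      simp only [Finset.mem_filter] at hc
      exact fun h => hc.2 h.2
  rw [Finset.sum_congr rfl fun S _ => h1 S, Finset.sum_comm]
  rw [Finset.sum_congr rfl (g := fun c : Fin n => #{j : Fin n | j < c} * (n - 1)!)]
  · rw [← Finset.sum_mul, ← mul_assoc, card_pairs_lt]
    cases n with
    | zero => simp
    | succ k => simp [Nat.factorial_succ]; ring
  · intro c _
    rw [Finset.sum_comm, Finset.sum_congr rfl (g := fun _ => (n - 1)!), Finset.sum_const,
      smul_eq_mul]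
    intro j hj
    rw [← Finset.sum_filter]
    exact sum_separating_factorial (by simpa using (Finset.mem_filter.mp hj).2.ne)

end Count

/-! ### The upper bound (n + 1)!/2 -/

section Layers

variable {B : Type*} [CommRing B] [Algebra ℂ B] {n : ℕ}

omit [Algebra ℂ B] in
lemma PsumMem.of_univ {L : Ideal B} {z : Fin n → B} (P : Finset (Fin n))
    (h : PsumMem L z univ) (hz : ∀ i, i ∉ P → z i ∈ L) : PsumMem L z P := by
  refine ⟨hz, fun k hk => ?_⟩
  have := h.2 k hk
  rw [← Finset.sum_add_sum_compl P] at this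
  refine (L.add_mem_iff_left (sum_mem fun i hi => ?_)).mp this
  exact L.pow_mem_of_mem (hz i (by simpa using hi)) k (by omega)

/-- Larger sets come first; among sets of the same size, those with a smaller sum of elements
come first. -/
def layerWeight (S : Finset (Fin n)) : ℕ ×ₗ ℤ := toLex (#S, -∑ i ∈ S, (i : ℤ))

lemma layerWeight_lt_of_card_lt {S T : Finset (Fin n)} (h : #S < #T) :
    layerWeight S < layerWeight T :=
  Prod.Lex.toLex_lt_toLex.mpr (Or.inl h)

/-- T arises from S by exchanging elements ≥ c for equally many elements ≤ c. The sum drops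
strictly, since c itself cannot be on both sides of the exchange. -/
lemma layerWeight_lt_of_chain {S T : Finset (Fin n)} {c : Fin n} (hcard : #T = #S) (hne : T ≠ S)
    (h1 : ∀ j ∈ S, j < c → j ∈ T) (h2 : ∀ i ∉ S, c < i → i ∉ T) :
    layerWeight S < layerWeight T := by
  refine Prod.Lex.toLex_lt_toLex.mpr (Or.inr ⟨hcard.symm, neg_lt_neg ?_⟩)
  have hc1 : #(T \ S) = #(S \ T) := by
    have := Finset.card_sdiff_add_card_inter T S
    have := Finset.card_sdiff_add_card_inter S T
    rw [Finset.inter_comm] at this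
    omega
  have hpos : 0 < #(T \ S) := by
    rw [Finset.card_pos, Finset.sdiff_nonempty]
    intro hTS
    exact hne (Finset.eq_of_subset_of_card_le hTS hcard.ge)
  have h3 := Finset.sum_inter_add_sum_sdiff T S (fun i => (i : ℤ))
  have h4 := Finset.sum_inter_add_sum_sdiff S T (fun i => (i : ℤ))
  rw [Finset.inter_comm] at h4
  have h5 : ∀ i ∈ T \ S, (i : ℤ) ≤ c := fun i hi => by
    rw [Finset.mem_sdiff] at hi
    by_contra hlt
    exact h2 i hi.2 (by rw [Fin.lt_def]; omega) hi.1
  have h6 : ∀ i ∈ S \ T, (c : ℤ) ≤ i := fun i hi => by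
    rw [Finset.mem_sdiff] at hi
    by_contra hlt
    exact hi.2 (h1 i hi.1 (by rw [Fin.lt_def]; omega))
  have h7 := Finset.sum_le_card_nsmul _ _ _ h5
  have h8 := Finset.card_nsmul_le_sum _ _ _ h6
  have hne' : ∀ i, i ≠ c → (i : ℤ) ≠ c := fun i h h' => h (Fin.ext (by exact_mod_cast h'))
  suffices ∑ i ∈ T \ S, (i : ℤ) < ∑ i ∈ S \ T, (i : ℤ) by linarith
  rw [hc1] at h7
  by_cases hc : c ∈ T
  · refine h7.trans_lt ?_
    rw [← Finset.sum_const]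
    refine Finset.sum_lt_sum_of_nonempty (Finset.card_pos.mp (hc1 ▸ hpos)) fun i hi => ?_
    refine lt_of_le_of_ne (h6 i hi) (hne' i ?_).symm
    rintro rfl
    exact (Finset.mem_sdiff.mp hi).2 hc
  · refine h8.trans_lt' ?_
    rw [← hc1, ← Finset.sum_const]
    refine Finset.sum_lt_sum_of_nonempty (Finset.card_pos.mp hpos) fun i hi => ?_
    refine lt_of_le_of_ne (h5 i hi) (hne' i ?_)
    rintro rfl
    exact hc (Finset.mem_sdiff.mp hi).1

variable {x y : Fin n → B} {I : Ideal B}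

/-- Multiply e_{|S|}(y) ∈ I by x_A y_D. A term y_T with T meeting A dies by xy = 0; if T does not
contain D, the term is divisible by y_{D ∪ T} with D ∪ T larger; the other T ≠ S come earlier by
hypothesis. Only the term y_S remains. -/
lemma mul_prod_mem_colonIdeal (hxy : ∀ i, x i * y i ∈ I)
    (hy : ∀ k, 1 ≤ k → ∑ i, y i ^ k ∈ I) {S : Finset (Fin n)} (hS : S.Nonempty)
    (A D : Finset (Fin n))
    (hwt : ∀ T : Finset (Fin n), #T = #S → T ≠ S → Disjoint A T → D ⊆ T →
      layerWeight S < layerWeight T) :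
    (∏ i ∈ A, x i) * ∏ j ∈ D, y j ∈ colonIdeal
      (I ⊔ Ideal.span ((fun T => ∏ j ∈ T, y j) '' {T | layerWeight S < layerWeight T}))
      (∏ j ∈ S, y j) := by
  set U := I ⊔ Ideal.span ((fun T => ∏ j ∈ T, y j) '' {T | layerWeight S < layerWeight T}) with hU
  have hIU : I ≤ U := le_sup_left
  have he : ∑ T ∈ univ.powersetCard #S, ∏ j ∈ T, y j ∈ I := by
    apply mem_of_mk_eq
    rw [map_sum, ← sum_powersetCard_prod_eq_zero univ (fun i => Ideal.Quotient.mk I (y i)) _ #S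
      hS.card_pos]
    · simp only [map_prod]
    · intro k hk
      have := Ideal.Quotient.eq_zero_iff_mem.mpr (hy k hk)
      simpa using this
  have hmem : S ∈ univ.powersetCard #S := by simp
  have h1 := U.mul_mem_left ((∏ i ∈ A, x i) * ∏ j ∈ D, y j) (hIU he)
  rw [Finset.mul_sum, ← Finset.add_sum_erase _ _ hmem] at h1
  rw [mem_colonIdeal, mul_comm]
  refine (U.add_mem_iff_left (sum_mem fun T hT => ?_)).mp h1
  simp only [Finset.mem_erase, Finset.mem_powersetCard_univ] at hT
  by_cases hd : Disjoint A T
  · by_cases hD : D ⊆ T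
    · exact U.mul_mem_left _ (Ideal.mem_sup_right (Ideal.subset_span
        ⟨T, hwt T hT.2 hT.1 hd hD, rfl⟩))
    · rw [mul_assoc, ← Finset.prod_union_inter]
      refine U.mul_mem_left _ (U.mul_mem_right _ (Ideal.mem_sup_right (Ideal.subset_span
        ⟨D ∪ T, layerWeight_lt_of_card_lt ?_, rfl⟩)))
      rw [← hT.2]
      refine Finset.card_lt_card ⟨Finset.subset_union_right, fun h => hD ?_⟩
      exact Finset.subset_union_left.trans h
  · obtain ⟨i, hiA, hiT⟩ := Finset.not_disjoint_iff.mp hd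
    refine hIU ?_
    rw [← Finset.mul_prod_erase A _ hiA, ← Finset.mul_prod_erase T _ hiT]
    have := I.mul_mem_right ((∏ i ∈ A.erase i, x i) * (∏ j ∈ D, y j) * ∏ j ∈ T.erase i, y j)
      (hxy i)
    convert this using 1
    ring

open Nat in
-- For S = ∅ all y vanish and the x give n!. Otherwise the relations of `mul_prod_mem_colonIdeal`
-- supply the hypotheses of the chain bound; the product of all x outside S arises because S is the
-- only set of its size disjoint from its complement.
lemma colength_layer_le
    (hgen : colength (Ideal.span (Set.range x) ⊔ Ideal.span (Set.range y)) ≤ 1)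
    (hxy : ∀ i, x i * y i ∈ I) (hx : ∀ k, 1 ≤ k → ∑ i, x i ^ k ∈ I)
    (hy : ∀ k, 1 ≤ k → ∑ i, y i ^ k ∈ I) (S : Finset (Fin n)) :
    colength (colonIdeal
      (I ⊔ Ideal.span ((fun T => ∏ j ∈ T, y j) '' {T | layerWeight S < layerWeight T}))
      (∏ j ∈ S, y j)) ≤ ((if S = ∅ then n ! else 0) +
        ∑ c ∈ Sᶜ, (#Sᶜ - 1)! * (#{j ∈ S | j < c} * (#S - 1)!) : ℕ) := by
  set U := I ⊔ Ideal.span ((fun T => ∏ j ∈ T, y j) '' {T | layerWeight S < layerWeight T}) with hU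
  set J := colonIdeal U (∏ j ∈ S, y j) with hJ
  have hIJ : I ≤ J := le_sup_left.trans (le_colonIdeal U _)
  have hyJ : ∀ i, i ∉ S → y i ∈ J := by
    intro i hi
    rw [hJ, mem_colonIdeal, mul_comm, ← Finset.prod_insert hi]
    refine Ideal.mem_sup_right (Ideal.subset_span ⟨insert i S, ?_, rfl⟩)
    exact layerWeight_lt_of_card_lt (by rw [Finset.card_insert_of_notMem hi]; omega)
  have hxJ : ∀ i, i ∉ Sᶜ → x i ∈ J := by
    intro i hi
    have hi : i ∈ S := by simpa using hi
    rw [hJ, mem_colonIdeal, ← Finset.mul_prod_erase S _ hi]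
    refine Ideal.mem_sup_left ?_
    have := I.mul_mem_right (∏ j ∈ S.erase i, y j) (hxy i)
    convert this using 1
    ring
  have hxP : PsumMem J x Sᶜ := .of_univ _ ⟨by simp, fun k hk => hIJ (hx k hk)⟩ hxJ
  have hyP : PsumMem J y S := .of_univ _ ⟨by simp, fun k hk => hIJ (hy k hk)⟩ hyJ
  by_cases hS : S = ∅
  · subst hS
    have h := hxP.colength_le
    rw [Finset.compl_empty, Finset.card_univ, Fintype.card_fin] at h
    refine h.trans ?_
    have h2 : colength (J ⊔ Ideal.span (Set.range x)) ≤ 1 := by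
      refine (colength_antitone (sup_le le_sup_right (Ideal.span_le.mpr ?_))).trans hgen
      rintro _ ⟨i, rfl⟩
      exact Ideal.mem_sup_left (hyJ i (by simp))
    refine (mul_le_mul_right h2 _).trans ?_
    simp
  · have hne := Finset.nonempty_iff_ne_empty.mpr hS
    rw [if_neg hS, zero_add]
    refine PsumMem.colength_le_of_chain hgen hxP hyP ?_ ?_
    · have := mul_prod_mem_colonIdeal hxy hy hne Sᶜ ∅ fun T hT hTS hd _ => ?_
      · rwa [Finset.prod_empty, mul_one] at this
      · refine absurd (Finset.eq_of_subset_of_card_le (fun i hi => ?_) hT.ge) hTS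
        by_contra hiS
        exact Finset.disjoint_left.mp hd (Finset.mem_compl.mpr hiS) hi
    · intro c _
      refine mul_prod_mem_colonIdeal hxy hy hne _ _ fun T hT hTS hd hD => ?_
      refine layerWeight_lt_of_chain (c := c) hT hTS (fun j hj hjc => hD (by simp [hj, hjc])) ?_
      intro i hi hci hiT
      exact Finset.disjoint_left.mp hd (by simp [hi, hci]) hiT

open Nat in
/-- Upper bound for the dimension of the coinvariant algebra of a double point. -/
theorem two_mul_colength_le (hn : 1 ≤ n)
    (hgen : colength (Ideal.span (Set.range x) ⊔ Ideal.span (Set.range y)) ≤ 1)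
    (hxy : ∀ i, x i * y i ∈ I) (hx : ∀ k, 1 ≤ k → ∑ i, x i ^ k ∈ I)
    (hy : ∀ k, 1 ≤ k → ∑ i, y i ^ k ∈ I) : 2 * colength I ≤ ((n + 1)! : ℕ) := by
  have h := colength_le_sum_colonIdeal I (fun T => ∏ j ∈ T, y j) layerWeight
    (univ : Finset (Finset (Fin n)))
  have h1 : I ⊔ Ideal.span (Set.range fun T : Finset (Fin n) => ∏ j ∈ T, y j) = ⊤ := by
    rw [Ideal.eq_top_iff_one]
    exact Ideal.mem_sup_right (Ideal.subset_span ⟨∅, by simp⟩)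
  rw [h1, colength_top, add_zero] at h
  have h2 : colength I ≤ (∑ S : Finset (Fin n), ((if S = ∅ then n ! else 0) +
        ∑ c ∈ Sᶜ, (#Sᶜ - 1)! * (#{j ∈ S | j < c} * (#S - 1)!)) : ℕ) := by
    refine LE.le.trans ?_ (h.trans ?_)
    · exact colength_antitone (sup_le le_rfl (Ideal.span_le.mpr (by simp)))
    · rw [Nat.cast_sum]
      exact Finset.sum_le_sum fun S _ => colength_layer_le hgen hxy hx hy S
  refine (mul_le_mul_right h2 2).trans ?_
  rw [Finset.sum_add_distrib, Finset.sum_ite_eq' univ ∅]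
  have h3 := two_mul_sum_layers n
  rw [← Nat.cast_ofNat, ← Nat.cast_mul, mul_add, h3]
  rw [if_pos (Finset.mem_univ _), Nat.factorial_succ]
  refine Nat.cast_le.mpr ?_
  -- With truncated subtraction, 2 + (n - 1) = n + 1 requires 1 ≤ n.
  cases n with
  | zero => omega
  | succ k => rw [Nat.add_sub_cancel, ← add_mul]; exact Nat.mul_le_mul_right _ (by omega)

end Layers

/-! ### Half the factorial, when products of all but one element vanish -/

section ErasedProducts

variable {B ι : Type*} [CommRing B] [Algebra ℂ B] [DecidableEq ι]

open Nat in
-- Filter by powers of one z_u. The layer of z_u⁰ is bounded by the full factorial for |P| - 1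
-- elements. Each later layer is also annihilated by the products omitting u and one more index, so
-- by induction it is bounded by half of that. Since z_u^{|P| - 1} is up to sign the product of the
-- other elements, it lies in L and there are only |P| - 2 later layers.
lemma PsumMem.two_mul_colength_le {z : ι → B} (p : ℕ) : ∀ {P : Finset ι} {L : Ideal B},
    #P = p + 2 → PsumMem L z P → (∀ u ∈ P, ∏ i ∈ P.erase u, z i ∈ L) →
    2 * colength L ≤ ((p + 2)! : ℕ) * colength (L ⊔ Ideal.span (Set.range z)) := by
  induction p with
  | zero =>
    intro P L hP h hprod
    obtain ⟨u, hu⟩ : P.Nonempty := Finset.card_pos.mp (by omega)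
    have hall : ∀ i, z i ∈ L := by
      intro i
      by_cases hi : i ∈ P
      · obtain ⟨v, hv⟩ : (P.erase i).Nonempty :=
          Finset.card_pos.mp (by rw [Finset.card_erase_of_mem hi]; omega)
        have h1 := hprod v (Finset.mem_of_mem_erase hv)
        have h2 : P.erase v = {i} := by
          refine (Finset.eq_of_subset_of_card_le ?_ ?_).symm
          · rw [Finset.singleton_subset_iff, Finset.mem_erase]
            exact ⟨(Finset.ne_of_mem_erase hv).symm, hi⟩
          · rw [Finset.card_erase_of_mem (Finset.mem_of_mem_erase hv), hP]; simp
        rwa [h2, Finset.prod_singleton] at h1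
      · exact h.1 i hi
    have : L ⊔ Ideal.span (Set.range z) = L := by
      rw [sup_eq_left, Ideal.span_le]
      rintro _ ⟨i, rfl⟩
      exact hall i
    rw [this]; simp
  | succ p ih =>
    intro P L hP h hprod
    obtain ⟨u, hu⟩ : P.Nonempty := Finset.card_pos.mp (by omega)
    set c := colength (L ⊔ Ideal.span (Set.range z)) with hc
    let L' := (L ⊔ Ideal.span {z u}) ⊔
      Ideal.span {b | ∃ v ∈ P.erase u, b = ∏ i ∈ (P.erase u).erase v, z i}
    have huL : z u ∈ L ⊔ Ideal.span {z u} :=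
      Ideal.mem_sup_right (Ideal.mem_span_singleton_self _)
    have h1 : PsumMem (L ⊔ Ideal.span {z u}) z (P.erase u) := (h.mono le_sup_left).erase hu huL
    have hcard : #(P.erase u) = p + 2 := by rw [Finset.card_erase_of_mem hu, hP]; omega
    have hle : ∀ {M : Ideal B}, L ≤ M → colength (M ⊔ Ideal.span (Set.range z)) ≤ c :=
      fun hM => colength_antitone (sup_le_sup_right hM _)
    have hb : 2 * colength L' ≤ ((p + 2)! : ℕ) * c :=
      (ih (L := L') hcard (h1.mono le_sup_left) fun v hv =>
        Ideal.mem_sup_right (Ideal.subset_span ⟨v, hv, rfl⟩)).trans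
        (mul_le_mul_right (hle (le_sup_left.trans le_sup_left)) _)
    have hbase : colength (L ⊔ Ideal.span {z u}) ≤ ((p + 2)! : ℕ) * c := by
      have := h1.colength_le
      rw [hcard] at this
      exact this.trans (mul_le_mul_right (hle le_sup_left) _)
    have key : ∀ j : ℕ, 2 * colength (L ⊔ Ideal.span {z u ^ (j + 1)}) ≤
        ((j + 2 : ℕ) * (p + 2)! : ℕ) * c := by
      intro j
      induction j with
      | zero =>
        rw [zero_add, zero_add, pow_one, Nat.cast_mul, mul_assoc]
        exact mul_le_mul_right hbase _
      | succ j ihj =>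
        have := colength_le_add (L ⊔ Ideal.span {z u ^ (j + 2)}) L' (z u ^ (j + 1)) ?_
        · refine (mul_le_mul_right this 2).trans ?_
          rw [mul_add, show j + 1 + 2 = (j + 2) + 1 by ring, add_mul, one_mul, Nat.cast_add,
            add_mul]
          refine add_le_add ((mul_le_mul_right (colength_antitone ?_) _).trans ihj) hb
          exact sup_le (le_sup_left.trans le_sup_left) le_sup_right
        · intro b hb
          obtain ⟨l, hl, d, hd, rfl⟩ := Submodule.mem_sup.mp hb
          obtain ⟨l', hl', e, he, rfl⟩ := Submodule.mem_sup.mp hl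
          obtain ⟨e, rfl⟩ := Ideal.mem_span_singleton'.mp he
          rw [mul_add, mul_add]
          refine add_mem (add_mem (Ideal.mem_sup_left (L.mul_mem_left _ hl')) ?_)
            (Ideal.mem_sup_left ?_)
          · exact Ideal.mem_sup_right (Ideal.mem_span_singleton'.mpr ⟨e, by ring⟩)
          · clear hb
            induction hd using Submodule.span_induction with
            | mem b hb =>
              obtain ⟨v, hv, rfl⟩ := hb
              have hvP := Finset.mem_of_mem_erase hv
              rw [pow_succ, mul_assoc, Finset.erase_right_comm, Finset.mul_prod_erase _ z
                (Finset.mem_erase.mpr ⟨(Finset.ne_of_mem_erase hv).symm, hu⟩)]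
              exact L.mul_mem_left _ (hprod v hvP)
            | zero => simp
            | add b b' _ _ hb hb' => rw [mul_add]; exact add_mem hb hb'
            | smul r b _ hb => rw [smul_eq_mul, mul_left_comm]; exact L.mul_mem_left _ hb
    have hpow : z u ^ (p + 1 + 1) ∈ L := by
      apply mem_of_mk_eq
      have := pow_card_pred_eq P _ h.mk_psum hu
      rw [hP] at this
      rw [map_pow]
      change Ideal.Quotient.mk L (z u) ^ (p + 1 + 1) = _ at this
      rw [this, ← map_prod, Ideal.Quotient.eq_zero_iff_mem.mpr (hprod u hu), mul_zero]
    have := key (p + 1)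
    rw [sup_eq_left.mpr ((Ideal.span_singleton_le_iff_mem _).mpr hpow)] at this
    rwa [show p + 1 + 2 = (p + 2) + 1 by ring, Nat.factorial_succ]

end ErasedProducts

/-! ### Filtered sections and degeneration of linear maps -/

section Sections

variable {V X : Type*} [AddCommGroup V] [Module ℂ V] [AddCommGroup X] [Module ℂ X]

/-- Lift the image of C in `V ⧸ M` back to C linearly, and extend the lift to all of `V ⧸ M`. -/
lemma exists_linear_lift (C : Submodule ℂ V) (M : Submodule ℂ V) :
    ∃ t : V →ₗ[ℂ] V, (∀ f ∈ M, t f = 0) ∧ (∀ f, t f ∈ C) ∧ ∀ f ∈ C, t f - f ∈ M := by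
  let q : C →ₗ[ℂ] V ⧸ M := M.mkQ ∘ₗ C.subtype
  obtain ⟨r, hr⟩ := q.rangeRestrict.exists_rightInverse_of_surjective (LinearMap.range_rangeRestrict q)
  obtain ⟨g, hg⟩ := r.exists_extend
  refine ⟨C.subtype ∘ₗ g ∘ₗ M.mkQ, fun f hf => ?_, fun f => (g _).2, fun f hf => ?_⟩
  · have : M.mkQ f = 0 := by simpa using hf
    rw [LinearMap.comp_apply, LinearMap.comp_apply, this, map_zero, map_zero]
  · rw [← Submodule.Quotient.mk_eq_zero, Submodule.Quotient.mk_sub, sub_eq_zero]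
    have h1 : g (M.mkQ f) = r (q.rangeRestrict ⟨f, hf⟩) := by
      rw [← hg]; rfl
    have h2 := congrArg Subtype.val (LinearMap.congr_fun hr (q.rangeRestrict ⟨f, hf⟩))
    change M.mkQ (g (M.mkQ f)) = M.mkQ f
    rw [h1]
    exact h2

/-- A linear projection along a subspace `I` of finite codimension, compatible with a
filtration. -/
lemma exists_filtered_section (C : ℕ → Submodule ℂ V) (hC : Monotone C) (h0 : C 0 = ⊥)
    (I : Submodule ℂ V) [FiniteDimensional ℂ (V ⧸ I)] :
    ∃ s : V →ₗ[ℂ] V, (∀ f ∈ I, s f = 0) ∧ (∀ d, ∀ f ∈ C d, s f ∈ C d) ∧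
      ∀ d, ∀ f ∈ C d, s f - f ∈ I := by
  have key : ∀ d, ∃ s : V →ₗ[ℂ] V, (∀ f ∈ I, s f = 0) ∧ (∀ e ≤ d, ∀ f ∈ C e, s f ∈ C e) ∧
      ∀ f ∈ C d, s f - f ∈ I := by
    intro d
    induction d with
    | zero =>
      refine ⟨0, by simp, by simp, fun f hf => ?_⟩
      rw [h0, Submodule.mem_bot] at hf
      simp [hf]
    | succ d ih =>
      obtain ⟨s, hs1, hs2, hs3⟩ := ih
      obtain ⟨t, ht1, ht2, ht3⟩ := exists_linear_lift (C (d + 1)) (C d ⊔ I)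
      -- `t` handles the part of C (d + 1) that is new modulo C d + I; the remainder f - t f lies in
      -- C d + I, where `s` already works.
      have hst : ∀ f ∈ C (d + 1), s (f - t f) ∈ C d ∧ s (f - t f) - (f - t f) ∈ I := by
        intro f hf
        have : f - t f ∈ C d ⊔ I := by
          have := neg_mem (ht3 f hf)
          rwa [neg_sub] at this
        obtain ⟨b, hb, i, hi, hbi⟩ := Submodule.mem_sup.mp this
        rw [← hbi, map_add, hs1 i hi, add_zero]
        refine ⟨hs2 d le_rfl b hb, ?_⟩
        rw [← sub_sub]
        exact sub_mem (hs3 b hb) hi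
      refine ⟨s ∘ₗ (LinearMap.id - t) + t, fun f hf => ?_, fun e he f hf => ?_, fun f hf => ?_⟩
      · have : t f = 0 := ht1 f (Submodule.mem_sup_right hf)
        simp [this, hs1 f hf]
      · rcases Nat.lt_succ_iff_lt_or_eq.mp (Nat.lt_succ_of_le he) with he | rfl
        · have : t f = 0 := ht1 f (Submodule.mem_sup_left (hC (by omega) hf))
          simpa [this] using hs2 e (by omega) f hf
        · exact add_mem (hC (Nat.le_succ d) (hst f hf).1) (ht2 f)
      · have := (hst f hf).2
        rw [sub_sub_eq_add_sub] at this
        exact this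
  -- The images of the C d in the finite-dimensional quotient stabilise at some N, so the section
  -- built for N serves for all d.
  obtain ⟨N, hN⟩ := WellFoundedGT.monotone_chain_condition
    (⟨fun d => (C d).map I.mkQ, fun a b h => Submodule.map_mono (hC h)⟩ :
      ℕ →o Submodule ℂ (V ⧸ I))
  obtain ⟨s, hs1, hs2, hs3⟩ := key N
  have hd : ∀ d, N ≤ d → ∀ f ∈ C d, s f ∈ C N ∧ s f - f ∈ I := by
    intro d hd f hf
    have h1 : I.mkQ f ∈ (C N).map I.mkQ := by
      have := hN d hd
      change (C N).map I.mkQ = (C d).map I.mkQ at this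
      rw [this]
      exact ⟨f, hf, rfl⟩
    obtain ⟨b, hb, hbf⟩ := h1
    have hI : b - f ∈ I := (Submodule.Quotient.eq I).mp hbf
    have hsb : s f = s b := (sub_eq_zero.mp ((map_sub s b f).symm.trans (hs1 _ hI))).symm
    rw [hsb]
    refine ⟨hs2 N le_rfl b hb, ?_⟩
    have := add_mem (hs3 b hb) hI
    rwa [sub_add_sub_cancel] at this
  refine ⟨s, hs1, fun d f hf => ?_, fun d f hf => ?_⟩
  · rcases le_total d N with h | h
    · exact hs2 d h f hf
    · exact hC h (hd d h f hf).1
  · rcases le_total d N with h | h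
    · exact hs3 f (hC h hf)
    · exact (hd d h f hf).2

variable {G : Type*} [Group G] [Fintype G]

/-- Average the conjugates of a filtered section; stability of I and of the filtration under G
preserves its other properties. -/
lemma exists_equivariant_filtered_section (ρ : Representation ℂ G V) (C : ℕ → Submodule ℂ V)
    (hC : Monotone C) (h0 : C 0 = ⊥) (I : Submodule ℂ V) [FiniteDimensional ℂ (V ⧸ I)]
    (hCρ : ∀ g d, ∀ f ∈ C d, ρ g f ∈ C d) (hIρ : ∀ g, ∀ f ∈ I, ρ g f ∈ I) :
    ∃ s : V →ₗ[ℂ] V, (∀ g f, s (ρ g f) = ρ g (s f)) ∧ (∀ f ∈ I, s f = 0) ∧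
      (∀ d, ∀ f ∈ C d, s f ∈ C d) ∧ ∀ d, ∀ f ∈ C d, s f - f ∈ I := by
  obtain ⟨s, hs1, hs2, hs3⟩ := exists_filtered_section C hC h0 I
  have hcard : (Fintype.card G : ℂ) ≠ 0 := by exact_mod_cast Fintype.card_ne_zero
  let t : V →ₗ[ℂ] V := (Fintype.card G : ℂ)⁻¹ • ∑ g : G, ρ g ∘ₗ s ∘ₗ ρ g⁻¹
  have ht : ∀ f, t f = (Fintype.card G : ℂ)⁻¹ • ∑ g : G, ρ g (s (ρ g⁻¹ f)) := by
    intro f; simp [t]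
  refine ⟨t, fun g f => ?_, fun f hf => ?_, fun d f hf => ?_, fun d f hf => ?_⟩
  · rw [ht, ht, map_smul, map_sum]
    congr 1
    rw [← Equiv.sum_comp (Equiv.mulLeft g) fun h => ρ h (s (ρ h⁻¹ (ρ g f)))]
    refine Finset.sum_congr rfl fun h _ => ?_
    rw [Equiv.coe_mulLeft, ← Module.End.mul_apply (ρ (g * h)⁻¹), ← map_mul,
      map_mul ρ g h, Module.End.mul_apply]
    congr 4
    group
  · rw [ht, Finset.sum_eq_zero, smul_zero]
    intro g _
    rw [hs1 _ (hIρ _ f hf), map_zero]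
  · rw [ht]
    exact (C d).smul_mem _ (sum_mem fun g _ => hCρ g d _ (hs2 d _ (hCρ _ d f hf)))
  · have : t f - f = (Fintype.card G : ℂ)⁻¹ • ∑ g : G, ρ g (s (ρ g⁻¹ f) - ρ g⁻¹ f) := by
      rw [ht]
      simp only [map_sub, Representation.self_inv_apply, Finset.sum_sub_distrib, Finset.sum_const,
        Finset.card_univ, smul_sub]
      rw [← Nat.cast_smul_eq_nsmul ℂ, smul_smul, inv_mul_cancel₀ hcard, one_smul]
    rw [this]
    exact I.smul_mem _ (sum_mem fun g _ => hIρ g _ (hs3 d _ (hCρ _ d f hf)))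

/-- The error s f - f lies in I and in the same filtration step as f, so φ cannot distinguish it
from some b one step lower. By induction b is hit by φ ∘ s, and subtracting the preimage corrects f.
Thus φ ∘ s vanishes wherever `s` does, yet reaches all values of φ on the filtration. -/
lemma exists_apply_section_eq {C : ℕ → Submodule ℂ V} (hC : Monotone C) (h0 : C 0 = ⊥)
    {I : Submodule ℂ V} {s : V →ₗ[ℂ] V} (hs : ∀ d, ∀ f ∈ C d, s f ∈ C d)
    (hsI : ∀ d, ∀ f ∈ C d, s f - f ∈ I) (φ : V →ₗ[ℂ] X)
    (H : ∀ d, ∀ f ∈ I, f ∈ C (d + 1) → ∃ b ∈ C d, φ f = φ b) (d : ℕ) :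
    ∀ f ∈ C d, ∃ r ∈ C d, φ (s r) = φ f := by
  induction d with
  | zero =>
    intro f hf
    refine ⟨f, hf, ?_⟩
    rw [h0, Submodule.mem_bot] at hf
    rw [hf, map_zero]
  | succ d ih =>
    intro f hf
    obtain ⟨b, hb, hfb⟩ := H d _ (hsI _ f hf) (sub_mem (hs _ f hf) hf)
    obtain ⟨r, hr, hrb⟩ := ih b hb
    refine ⟨f - r, sub_mem hf (hC (Nat.le_succ d) hr), ?_⟩
    rw [map_sub, map_sub, hrb, ← hfb, map_sub]
    abel

/-- If the leading parts of elements of `I` are leading parts of elements of the kernel of `φ`, and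
the codimension of `I` is at most the rank of `φ`, the converse holds as well. -/
lemma mem_sup_of_finrank_le {C : ℕ → Submodule ℂ V} (hC : Monotone C) (h0 : C 0 = ⊥)
    (hex : ∀ f, ∃ d, f ∈ C d) {I : Submodule ℂ V} [FiniteDimensional ℂ (V ⧸ I)] (φ : V →ₗ[ℂ] X)
    (hφ : Function.Surjective φ) [FiniteDimensional ℂ X]
    (H : ∀ d, ∀ f ∈ I, f ∈ C (d + 1) → ∃ b ∈ C d, φ f = φ b)
    (hrank : Module.finrank ℂ (V ⧸ I) ≤ Module.finrank ℂ X)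
    {d : ℕ} {f : V} (hf : φ f = 0) (hfd : f ∈ C (d + 1)) : f ∈ I ⊔ C d := by
  obtain ⟨s, hs1, hs2, hs3⟩ := exists_filtered_section C hC h0 I
  let θ : (V ⧸ I) →ₗ[ℂ] X := I.liftQ (φ ∘ₗ s) fun f hf => by
    rw [LinearMap.mem_ker, LinearMap.comp_apply, hs1 f hf, map_zero]
  have hθ : Function.Surjective θ := fun a => by
    obtain ⟨f, rfl⟩ := hφ a
    obtain ⟨d, hd⟩ := hex f
    obtain ⟨r, _, hr⟩ := exists_apply_section_eq hC h0 hs2 hs3 φ H d f hd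
    exact ⟨I.mkQ r, hr⟩
  have hinj : Function.Injective θ := by
    have h1 := LinearMap.finrank_le_finrank_of_surjective hθ
    exact (LinearMap.injective_iff_surjective_of_finrank_eq_finrank (le_antisymm hrank h1)).mpr hθ
  -- Since φ f = 0, φ (s f) is the value of φ on the error and equals φ (s r) for some r in C d;
  -- injectivity of θ then puts f - r into I.
  obtain ⟨b, hb, hfb⟩ := H d _ (hs3 _ f hfd) (sub_mem (hs2 _ f hfd) hfd)
  obtain ⟨r, hr, hrb⟩ := exists_apply_section_eq hC h0 hs2 hs3 φ H d b hb
  rw [map_sub, hf, sub_zero, ← hrb] at hfb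
  have : I.mkQ f = I.mkQ r := hinj hfb
  have hI : f - r ∈ I := (Submodule.Quotient.eq I).mp this
  have := Submodule.add_mem_sup hI hr
  rwa [sub_add_cancel] at this

end Sections

/-! ### Homogeneous components and leading forms -/

section Grading

open MvPolynomial

variable {σ : Type*}

lemma homogeneousComponent_mul_of_le {g f : MvPolynomial σ ℂ} {c : ℕ} (hg : g.IsHomogeneous c)
    (e : ℕ) :
    homogeneousComponent e (g * f) = if c ≤ e then g * homogeneousComponent (e - c) f else 0 := by
  conv_lhs => rw [← sum_homogeneousComponent f]
  rw [Finset.mul_sum, map_sum]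
  have h1 : ∀ i, homogeneousComponent e (g * homogeneousComponent i f) =
      if e = c + i then g * homogeneousComponent i f else 0 := fun i =>
    homogeneousComponent_of_mem (hg.mul (homogeneousComponent_isHomogeneous i f))
  rw [Finset.sum_congr rfl fun i _ => h1 i]
  split_ifs with hce
  · by_cases hd : e - c < f.totalDegree + 1
    · rw [Finset.sum_eq_single_of_mem (e - c) (Finset.mem_range.mpr hd), if_pos (by omega)]
      intro i _ hi
      exact if_neg (by omega)
    · rw [homogeneousComponent_eq_zero _ _ (by omega : f.totalDegree < e - c), mul_zero]
      refine Finset.sum_eq_zero fun i hi => if_neg ?_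
      rw [Finset.mem_range] at hi
      omega
  · exact Finset.sum_eq_zero fun i _ => if_neg (by omega)

variable (σ) in
/-- The polynomials of degree less than `d`. -/
def degLT (d : ℕ) : Submodule ℂ (MvPolynomial σ ℂ) where
  carrier := {f | ∀ e, d ≤ e → homogeneousComponent e f = 0}
  add_mem' hf hg e he := by rw [map_add, hf e he, hg e he, add_zero]
  zero_mem' e _ := map_zero _
  smul_mem' c f hf e he := by rw [map_smul, hf e he, smul_zero]

lemma degLT_mono : Monotone (degLT σ) := fun _ _ h _ hf e he => hf e (h.trans he)

lemma degLT_zero : degLT σ 0 = ⊥ := by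
  rw [Submodule.eq_bot_iff]
  intro f hf
  rw [← sum_homogeneousComponent f]
  exact Finset.sum_eq_zero fun i _ => hf i (Nat.zero_le i)

lemma exists_mem_degLT (f : MvPolynomial σ ℂ) : ∃ d, f ∈ degLT σ d :=
  ⟨f.totalDegree + 1, fun _ he => homogeneousComponent_eq_zero _ _ he⟩

lemma sub_homogeneousComponent_mem_degLT {f : MvPolynomial σ ℂ} {d : ℕ}
    (hf : f ∈ degLT σ (d + 1)) : f - homogeneousComponent d f ∈ degLT σ d := by
  intro e he
  rw [map_sub, homogeneousComponent_of_mem (homogeneousComponent_isHomogeneous d f)]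
  split_ifs with h
  · rw [h, sub_self]
  · rw [sub_zero]; exact hf e (by omega)

lemma mem_degLT_of_isHomogeneous {f : MvPolynomial σ ℂ} {d : ℕ} (hf : f.IsHomogeneous d) :
    f ∈ degLT σ (d + 1) := by
  intro e he
  rw [homogeneousComponent_of_mem hf, if_neg (by omega)]

lemma C_mem_degLT (c : ℂ) {d : ℕ} (hd : d ≠ 0) : C c ∈ degLT σ d :=
  degLT_mono (by omega : 0 + 1 ≤ d) (mem_degLT_of_isHomogeneous (isHomogeneous_C σ c))

lemma mul_mem_degLT {g f : MvPolynomial σ ℂ} {c d : ℕ} (hg : g.IsHomogeneous c)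
    (hf : f ∈ degLT σ d) : g * f ∈ degLT σ (c + d) := by
  intro e he
  rw [homogeneousComponent_mul_of_le hg, if_pos (by omega), hf _ (by omega), mul_zero]

lemma rename_mem_degLT {τ : Type*} {f : MvPolynomial σ ℂ} {d : ℕ} (u : σ → τ)
    (hf : f ∈ degLT σ d) : rename u f ∈ degLT τ d := by
  intro e he
  rw [← rename_homogeneousComponent, hf e he, map_zero]

/-- The ideal of all polynomials whose component of degree `e` belongs to `N e`, for all `e`. -/
def componentIdeal (N : ℕ → Submodule ℂ (MvPolynomial σ ℂ))
    (hN : ∀ {c e : ℕ} {g f : MvPolynomial σ ℂ}, g.IsHomogeneous c → f ∈ N e → g * f ∈ N (c + e)) :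
    Ideal (MvPolynomial σ ℂ) where
  carrier := {f | ∀ e, homogeneousComponent e f ∈ N e}
  add_mem' hf hg e := by rw [map_add]; exact add_mem (hf e) (hg e)
  zero_mem' e := by rw [map_zero]; exact zero_mem _
  smul_mem' g f hf e := by
    rw [smul_eq_mul, ← sum_homogeneousComponent g, Finset.sum_mul, map_sum]
    refine sum_mem fun c _ => ?_
    rw [homogeneousComponent_mul_of_le (homogeneousComponent_isHomogeneous c g)]
    split_ifs with hc
    · have := hN (homogeneousComponent_isHomogeneous c g) (hf (e - c))
      rwa [Nat.add_sub_cancel' hc] at this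
    · exact zero_mem _

/-- The largest homogeneous ideal contained in `K`. -/
def homCore (K : Ideal (MvPolynomial σ ℂ)) : Ideal (MvPolynomial σ ℂ) :=
  componentIdeal (fun _ => K.restrictScalars ℂ) fun _ hf => K.mul_mem_left _ hf

/-- The ideal of all polynomials whose homogeneous components are leading parts of elements
of `K`. -/
def leadIdeal (K : Ideal (MvPolynomial σ ℂ)) : Ideal (MvPolynomial σ ℂ) :=
  componentIdeal (fun e => K.restrictScalars ℂ ⊔ degLT σ e) fun {c e g f} hg hf => by
    obtain ⟨k, hk, l, hl, rfl⟩ := Submodule.mem_sup.mp hf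
    rw [mul_add]
    exact Submodule.add_mem_sup (K.mul_mem_left _ hk) (mul_mem_degLT hg hl)

lemma mem_homCore_of_isHomogeneous {K : Ideal (MvPolynomial σ ℂ)} {f : MvPolynomial σ ℂ} {d : ℕ}
    (hf : f.IsHomogeneous d) (hK : f ∈ K) : f ∈ homCore K := by
  intro e
  rw [homogeneousComponent_of_mem hf]
  split_ifs
  · exact hK
  · exact zero_mem _

lemma homCore_le_leadIdeal (K : Ideal (MvPolynomial σ ℂ)) : homCore K ≤ leadIdeal K :=
  fun _ hf e => Submodule.mem_sup_left (hf e)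

lemma leadIdeal_mono {K K' : Ideal (MvPolynomial σ ℂ)} (h : K ≤ K') :
    leadIdeal K ≤ leadIdeal K' :=
  fun _ hf e => (sup_le_sup_right (show K.restrictScalars ℂ ≤ K'.restrictScalars ℂ from h) _ :
    K.restrictScalars ℂ ⊔ degLT σ e ≤ K'.restrictScalars ℂ ⊔ degLT σ e) (hf e)

lemma exists_sub_mem_of_mem_leadIdeal {K : Ideal (MvPolynomial σ ℂ)} {f : MvPolynomial σ ℂ}
    {d : ℕ} (hf : f ∈ leadIdeal K) (hd : f ∈ degLT σ (d + 1)) : ∃ b ∈ degLT σ d, f - b ∈ K := by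
  obtain ⟨k, hk, l, hl, hkl⟩ := Submodule.mem_sup.mp (hf d)
  refine ⟨l + (f - homogeneousComponent d f),
    add_mem hl (sub_homogeneousComponent_mem_degLT hd), ?_⟩
  rw [← hkl, show f - (l + (f - (k + l))) = k by ring]
  exact hk

end Grading

/-! ### The coinvariant ideal in the polynomial ring -/

section PolynomialModel

open MvPolynomial

/-- The polynomial ring in `x₁, …, xₙ, y₁, …, yₙ`, where `xᵢ` is the variable `(i, 0)` and `yᵢ` is
the variable `(i, 1)`. -/
abbrev PolyXY (n : ℕ) : Type := MvPolynomial (Fin n × Fin 2) ℂ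

variable {n : ℕ}

/-- The action of a permutation of the indices on polynomials. -/
def act (σ : Equiv.Perm (Fin n)) : PolyXY n →ₐ[ℂ] PolyXY n := rename (Prod.map σ id)

@[simp]
lemma act_X (σ : Equiv.Perm (Fin n)) (i : Fin n) (b : Fin 2) :
    act σ (X (i, b)) = X (σ i, b) := rename_X _ _

lemma act_one : act (1 : Equiv.Perm (Fin n)) = AlgHom.id ℂ (PolyXY n) := by
  ext ⟨i, b⟩ : 1
  simp

lemma act_mul (σ τ : Equiv.Perm (Fin n)) : act (σ * τ) = (act σ).comp (act τ) := by
  ext ⟨i, b⟩ : 1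
  simp

@[simp]
lemma act_one_apply (f : PolyXY n) : act 1 f = f := by rw [act_one]; rfl

lemma act_mul_apply (σ τ : Equiv.Perm (Fin n)) (f : PolyXY n) :
    act (σ * τ) f = act σ (act τ f) := by rw [act_mul]; rfl

lemma act_mem_degLT (σ : Equiv.Perm (Fin n)) {f : PolyXY n} {d : ℕ} (hf : f ∈ degLT _ d) :
    act σ f ∈ degLT _ d := rename_mem_degLT _ hf

lemma act_homogeneousComponent (σ : Equiv.Perm (Fin n)) (e : ℕ) (f : PolyXY n) :
    act σ (homogeneousComponent e f) = homogeneousComponent e (act σ f) :=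
  rename_homogeneousComponent e f

variable (n) in
/-- The permutation representation on polynomials. -/
def polyRep : Representation ℂ (Equiv.Perm (Fin n)) (PolyXY n) where
  toFun σ := (act σ).toLinearMap
  map_one' := by rw [act_one]; rfl
  map_mul' σ τ := by rw [act_mul]; rfl

@[simp]
lemma polyRep_apply (σ : Equiv.Perm (Fin n)) (f : PolyXY n) : polyRep n σ f = act σ f := rfl

variable (n) in
/-- The ideal generated by the equations `xᵢ yᵢ = 0` and by the symmetric polynomials without
constant term. -/
def symIdeal : Ideal (PolyXY n) :=
  Ideal.span (Set.range (fun i : Fin n => X (i, 0) * X (i, 1)) ∪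
    {f | (∀ σ, act σ f = f) ∧ constantCoeff f = 0})

lemma X_mul_X_mem_symIdeal (i : Fin n) : X (i, 0) * X (i, 1) ∈ symIdeal n :=
  Ideal.subset_span (Or.inl ⟨i, rfl⟩)

lemma mem_symIdeal_of_symm {f : PolyXY n} (hf : ∀ σ, act σ f = f) (h0 : constantCoeff f = 0) :
    f ∈ symIdeal n :=
  Ideal.subset_span (Or.inr ⟨hf, h0⟩)

lemma sub_C_mem_symIdeal {f : PolyXY n} (hf : ∀ σ, act σ f = f) :
    f - C (constantCoeff f) ∈ symIdeal n := by
  refine mem_symIdeal_of_symm (fun σ => ?_) (by simp)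
  rw [map_sub, hf]
  congr 1
  exact rename_C _ _

lemma psum_mem_symIdeal (b : Fin 2) (k : ℕ) (hk : 1 ≤ k) :
    ∑ i : Fin n, (X (i, b) : PolyXY n) ^ k ∈ symIdeal n := by
  refine mem_symIdeal_of_symm (fun σ => ?_) ?_
  · simp only [map_sum, map_pow, act_X]
    exact Equiv.sum_comp σ fun i => (X (i, b) : PolyXY n) ^ k
  · simp [show k ≠ 0 by omega]

lemma symIdeal_le_iff {K : Ideal (PolyXY n)} : symIdeal n ≤ K ↔
    (∀ i, X (i, 0) * X (i, 1) ∈ K) ∧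
      ∀ f, (∀ σ, act σ f = f) → constantCoeff f = 0 → f ∈ K := by
  rw [symIdeal, Ideal.span_le, Set.union_subset_iff, Set.range_subset_iff]
  exact and_congr Iff.rfl ⟨fun h f h1 h2 => h ⟨h1, h2⟩, fun h f hf => h f hf.1 hf.2⟩

lemma act_mem_of_generators {K : Ideal (PolyXY n)} {s : Set (PolyXY n)} (hK : K = Ideal.span s)
    (hs : ∀ σ, ∀ f ∈ s, act σ f ∈ K) (σ : Equiv.Perm (Fin n)) {f : PolyXY n} (hf : f ∈ K) :
    act σ f ∈ K := by
  have : K ≤ K.comap (act σ) := by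
    conv_lhs => rw [hK]
    exact Ideal.span_le.mpr (hs σ)
  exact this hf

lemma act_mem_symIdeal (σ : Equiv.Perm (Fin n)) {f : PolyXY n} (hf : f ∈ symIdeal n) :
    act σ f ∈ symIdeal n := by
  refine act_mem_of_generators rfl (fun σ f hf => ?_) σ hf
  rcases hf with ⟨i, rfl⟩ | hf
  · change act σ (X (i, 0) * X (i, 1)) ∈ symIdeal n
    rw [map_mul, act_X, act_X]
    exact X_mul_X_mem_symIdeal (σ i)
  · rw [hf.1 σ]
    exact mem_symIdeal_of_symm hf.1 hf.2

lemma isHomogeneous_X_mul_X (i : Fin n) :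
    (X (i, 0) * X (i, 1) : PolyXY n).IsHomogeneous 2 :=
  (isHomogeneous_X ℂ _).mul (isHomogeneous_X ℂ _)

lemma homogeneousComponent_zero_eq_zero {f : PolyXY n} (h0 : constantCoeff f = 0) :
    homogeneousComponent 0 f = 0 := by
  rw [homogeneousComponent_zero, ← constantCoeff_eq, h0, C_0]

/-- The ideal is homogeneous, because the action preserves degree and so components of symmetric
polynomials are symmetric. -/
lemma symIdeal_le_homCore : symIdeal n ≤ homCore (symIdeal n) := by
  refine symIdeal_le_iff.mpr ⟨fun i => mem_homCore_of_isHomogeneous (isHomogeneous_X_mul_X i)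
    (X_mul_X_mem_symIdeal i), fun f hf h0 e => ?_⟩
  rcases Nat.eq_zero_or_pos e with rfl | he
  · rw [homogeneousComponent_zero_eq_zero h0]; exact zero_mem _
  · refine mem_symIdeal_of_symm (fun σ => by rw [act_homogeneousComponent, hf]) ?_
    rw [constantCoeff_eq, coeff_homogeneousComponent, if_neg (by simp; omega)]

/-- A criterion for all elements of `symIdeal n` to be leading parts of elements of `K`: symmetric
polynomials have to be constant modulo `K`. -/
lemma symIdeal_le_leadIdeal {K : Ideal (PolyXY n)} (hxy : ∀ i, X (i, 0) * X (i, 1) ∈ K)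
    (hsymm : ∀ f : PolyXY n, (∀ σ, act σ f = f) → ∃ c : ℂ, f - C c ∈ K) :
    symIdeal n ≤ leadIdeal K := by
  refine symIdeal_le_iff.mpr ⟨fun i => homCore_le_leadIdeal K
    (mem_homCore_of_isHomogeneous (isHomogeneous_X_mul_X i) (hxy i)), fun f hf h0 e => ?_⟩
  rcases Nat.eq_zero_or_pos e with rfl | he
  · rw [homogeneousComponent_zero_eq_zero h0]; exact zero_mem _
  · obtain ⟨c, hc⟩ := hsymm (homogeneousComponent e f)
      fun σ => by rw [act_homogeneousComponent, hf]
    have := Submodule.add_mem_sup (show _ ∈ K.restrictScalars ℂ from hc)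
      (C_mem_degLT (σ := Fin n × Fin 2) c (by omega : e ≠ 0))
    rwa [sub_add_cancel] at this

lemma colength_variables_le : colength
    (Ideal.span (Set.range fun i : Fin n => (X (i, 0) : PolyXY n)) ⊔
      Ideal.span (Set.range fun i : Fin n => (X (i, 1) : PolyXY n))) ≤ 1 := by
  set J := Ideal.span (Set.range fun i : Fin n => (X (i, 0) : PolyXY n)) ⊔
      Ideal.span (Set.range fun i : Fin n => (X (i, 1) : PolyXY n)) with hJ
  have hX : ∀ p : Fin n × Fin 2, (X p : PolyXY n) ∈ J := by
    rintro ⟨i, b⟩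
    fin_cases b
    · exact Ideal.mem_sup_left (Ideal.subset_span ⟨i, rfl⟩)
    · exact Ideal.mem_sup_right (Ideal.subset_span ⟨i, rfl⟩)
  have h : Ideal.Quotient.mkₐ ℂ J =
      (Algebra.ofId ℂ (PolyXY n ⧸ J)).comp (aeval fun _ => (0 : ℂ)) := by
    ext p
    simp only [AlgHom.comp_apply, aeval_X, map_zero]
    exact Ideal.Quotient.eq_zero_iff_mem.mpr (hX p)
  have hs : Function.Surjective (Algebra.linearMap ℂ (PolyXY n ⧸ J)) := by
    intro q
    obtain ⟨f, rfl⟩ := Ideal.Quotient.mk_surjective q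
    exact ⟨_, (DFunLike.congr_fun h f).symm⟩
  refine (Module.length_le_of_surjective _ hs).trans (le_of_eq ?_)
  rw [Module.length_eq_finrank, Module.finrank_self, Nat.cast_one]

lemma finiteDimensional_of_colength_ne_top {B : Type*} [CommRing B] [Algebra ℂ B] {L : Ideal B}
    (h : colength L ≠ ⊤) : FiniteDimensional ℂ (B ⧸ L) := by
  have := Module.length_ne_top_iff.mp h
  obtain ⟨h1, h2⟩ := isFiniteLength_iff_isNoetherian_isArtinian.mp this
  infer_instance

lemma ne_top_of_two_mul_le {a : ℕ∞} {m : ℕ} (h : 2 * a ≤ m) : a ≠ ⊤ := by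
  rintro rfl
  rw [ENat.mul_top (by norm_num)] at h
  exact absurd h (by simp)

lemma finrank_le_of_two_mul_colength_le {B : Type*} [CommRing B] [Algebra ℂ B] {L : Ideal B}
    {m : ℕ} (h : 2 * colength L ≤ m) : 2 * Module.finrank ℂ (B ⧸ L) ≤ m := by
  have := finiteDimensional_of_colength_ne_top (ne_top_of_two_mul_le h)
  rw [colength, Module.length_eq_finrank] at h
  exact_mod_cast h

lemma two_mul_colength_symIdeal_le (hn : 1 ≤ n) :
    2 * colength (symIdeal n) ≤ ((n + 1).factorial : ℕ) :=
  two_mul_colength_le hn colength_variables_le X_mul_X_mem_symIdeal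
    (psum_mem_symIdeal 0) (psum_mem_symIdeal 1)

end PolynomialModel

/-! ### The facet ideal -/

open MvPolynomial

/-- The ideal generated by the products of all but one of the variables `yᵢ`. -/
def facetIdeal (n : ℕ) : Ideal (PolyXY n) :=
  Ideal.span (Set.range fun i : Fin n => ∏ j ∈ univ.erase i, X (j, 1))

section FacetIdeal

variable {n : ℕ}

lemma prod_erase_mem_facetIdeal (i : Fin n) :
    ∏ j ∈ univ.erase i, (X (j, 1) : PolyXY n) ∈ facetIdeal n :=
  Ideal.subset_span ⟨i, rfl⟩

lemma act_prod_erase (σ : Equiv.Perm (Fin n)) (i : Fin n) :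
    act σ (∏ j ∈ univ.erase i, X (j, 1)) = ∏ j ∈ univ.erase (σ i), X (j, 1) := by
  rw [map_prod]
  simp only [act_X]
  refine Finset.prod_bij (fun j _ => σ j) ?_ ?_ ?_ ?_
  · intro j hj
    simpa using hj
  · intro j _ k _ h
    exact σ.injective h
  · intro j hj
    refine ⟨σ.symm j, ?_, by simp⟩
    rw [Finset.mem_erase] at hj ⊢
    exact ⟨fun h => hj.1 (by rw [← h, Equiv.apply_symm_apply]), Finset.mem_univ _⟩
  · intro j _
    rfl

lemma act_mem_facetIdeal (σ : Equiv.Perm (Fin n)) {f : PolyXY n} (hf : f ∈ facetIdeal n) :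
    act σ f ∈ facetIdeal n := by
  refine act_mem_of_generators rfl (fun σ f hf => ?_) σ hf
  obtain ⟨i, rfl⟩ := hf
  change act σ (∏ j ∈ univ.erase i, X (j, 1)) ∈ facetIdeal n
  rw [act_prod_erase]
  exact prod_erase_mem_facetIdeal _

lemma facetIdeal_le_homCore {K : Ideal (PolyXY n)}
    (hK : ∀ i : Fin n, ∏ j ∈ univ.erase i, X (j, 1) ∈ K) : facetIdeal n ≤ homCore K := by
  refine Ideal.span_le.mpr ?_
  rintro _ ⟨i, rfl⟩
  exact mem_homCore_of_isHomogeneous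
    (IsHomogeneous.prod _ _ (fun _ => 1) fun j _ => isHomogeneous_X ℂ _) (hK i)

end FacetIdeal

/-! ### Moving one of n + 1 points to x = 1, y = 0 -/

section Extension

variable {n : ℕ}

/-- The extension of a permutation of the first `n` indices that fixes the last index. -/
def extPerm : Equiv.Perm (Fin n) →* Equiv.Perm (Fin (n + 1)) :=
  Equiv.Perm.viaEmbeddingHom Fin.castSuccEmb

@[simp]
lemma extPerm_castSucc (u : Equiv.Perm (Fin n)) (i : Fin n) :
    extPerm u i.castSucc = (u i).castSucc :=
  Equiv.Perm.viaEmbedding_apply u Fin.castSuccEmb i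

@[simp]
lemma extPerm_last (u : Equiv.Perm (Fin n)) : extPerm u (Fin.last n) = Fin.last n :=
  Equiv.Perm.viaEmbedding_apply_of_notMem u Fin.castSuccEmb _ (by
    rintro ⟨i, hi⟩
    exact (Fin.castSucc_lt_last i).ne hi)

lemma exists_extPerm_eq (w : Equiv.Perm (Fin (n + 1))) (hw : w (Fin.last n) = Fin.last n) :
    ∃ u, extPerm u = w := by
  have h : ∀ (w : Equiv.Perm (Fin (n + 1))), w (Fin.last n) = Fin.last n →
      ∀ i : Fin n, w i.castSucc ≠ Fin.last n := fun w hw i h =>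
    (Fin.castSucc_lt_last i).ne (w.injective (h.trans hw.symm))
  have hw' : w.symm (Fin.last n) = Fin.last n := by rw [Equiv.symm_apply_eq, hw]
  refine ⟨⟨fun i => (w i.castSucc).castPred (h w hw i),
    fun i => (w.symm i.castSucc).castPred (h w.symm hw' i), fun i => by simp, fun i => by simp⟩,
    Equiv.ext fun i => ?_⟩
  induction i using Fin.lastCases with
  | last => rw [extPerm_last, hw]
  | cast i => rw [extPerm_castSucc]; simp

/-- Specialization of the last point to `x = 1`, `y = 0`. -/
def specLast : PolyXY (n + 1) →ₐ[ℂ] PolyXY n :=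
  aeval fun p => Fin.snoc (α := fun _ => PolyXY n) (fun j => X (j, p.2))
    (if p.2 = 0 then 1 else 0) p.1

@[simp]
lemma specLast_X_castSucc (j : Fin n) (b : Fin 2) : specLast (X (j.castSucc, b)) = X (j, b) := by
  rw [specLast, aeval_X]; simp

@[simp]
lemma specLast_X_last_zero : specLast (X (Fin.last n, 0)) = 1 := by
  rw [specLast, aeval_X]; simp

@[simp]
lemma specLast_X_last_one : specLast (X (Fin.last n, 1)) = 0 := by
  rw [specLast, aeval_X]; simp

lemma specLast_act_extPerm (u : Equiv.Perm (Fin n)) (f : PolyXY (n + 1)) :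
    specLast (act (extPerm u) f) = act u (specLast f) := by
  suffices h : (specLast.comp (act (extPerm u)) : PolyXY (n + 1) →ₐ[ℂ] PolyXY n) =
    (act u).comp specLast from DFunLike.congr_fun h f
  ext ⟨i, b⟩ : 1
  induction i using Fin.lastCases with
  | last => fin_cases b <;> simp
  | cast i => simp

lemma specLast_surjective : Function.Surjective (specLast (n := n)) := by
  intro g
  refine ⟨rename (Prod.map Fin.castSucc id) g, ?_⟩
  suffices h : (specLast.comp (rename (Prod.map Fin.castSucc id)) : PolyXY n →ₐ[ℂ] PolyXY n) =
    AlgHom.id ℂ _ from DFunLike.congr_fun h g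
  ext ⟨i, b⟩ : 1
  simp

lemma X_pow_mem_symIdeal (j : Fin n) (b : Fin 2) : (X (j, b) : PolyXY n) ^ n ∈ symIdeal n := by
  apply mem_of_mk_eq
  have := pow_card_eq_zero univ (fun i => Ideal.Quotient.mk (symIdeal n) (X (i, b))) (fun k hk => by
    have := Ideal.Quotient.eq_zero_iff_mem.mpr (psum_mem_symIdeal (n := n) b k hk)
    simpa using this) (Finset.mem_univ j)
  rw [Finset.card_univ, Fintype.card_fin] at this
  rw [map_pow]
  exact this

/-- The n-th power of the last x specialises to 1 for permutations fixing the last index, and to an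
element of `symIdeal n` otherwise. It thereby separates the cosets of S_n in S_{n+1}. -/
lemma specLast_act_pow_mem {w : Equiv.Perm (Fin (n + 1))} (hw : w (Fin.last n) ≠ Fin.last n) :
    specLast (act w (X (Fin.last n, 0) ^ n)) ∈ symIdeal n := by
  obtain ⟨j, hj⟩ := Fin.exists_castSucc_eq.mpr hw
  rw [map_pow, act_X, ← hj, map_pow, specLast_X_castSucc]
  exact X_pow_mem_symIdeal j 0

/-- The polynomials that vanish modulo the coinvariant ideal after moving any of the points to
`x = 1`, `y = 0`. -/
def specIdeal (n : ℕ) : Ideal (PolyXY (n + 1)) :=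
  ⨅ w : Equiv.Perm (Fin (n + 1)), (symIdeal n).comap (specLast.comp (act w))

lemma mem_specIdeal {f : PolyXY (n + 1)} :
    f ∈ specIdeal n ↔ ∀ w, specLast (act w f) ∈ symIdeal n := by
  simp [specIdeal, Ideal.mem_comap]

lemma specLast_X_mul_X_mem (i : Fin (n + 1)) :
    specLast (X (i, 0) * X (i, 1)) ∈ symIdeal n := by
  induction i using Fin.lastCases with
  | last => simp
  | cast i => simpa using X_mul_X_mem_symIdeal i

lemma prod_mem_symIdeal (hn : 1 ≤ n) : ∏ j : Fin n, (X (j, 1) : PolyXY n) ∈ symIdeal n := by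
  refine mem_symIdeal_of_symm (fun σ => ?_) ?_
  · rw [map_prod]
    simp only [act_X]
    exact Equiv.prod_comp σ fun i => (X (i, 1) : PolyXY n)
  · rw [map_prod]
    exact Finset.prod_eq_zero (Finset.mem_univ ⟨0, hn⟩) (by simp)

/-- A polynomial symmetric in n + 1 points specialises to one symmetric in n points, hence constant
modulo `symIdeal n`. A product of all but one y either contains the last y, which becomes 0, or
becomes y_1 ⋯ y_n, symmetric without constant term. -/
lemma symIdeal_sup_facetIdeal_le (hn : 1 ≤ n) :
    symIdeal (n + 1) ⊔ facetIdeal (n + 1) ≤ leadIdeal (specIdeal n) := by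
  refine sup_le (symIdeal_le_leadIdeal (fun i => mem_specIdeal.mpr fun w => ?_) fun f hf => ?_)
    ((facetIdeal_le_homCore fun i => mem_specIdeal.mpr fun w => ?_).trans
      (homCore_le_leadIdeal _))
  · rw [map_mul, act_X, act_X]
    exact specLast_X_mul_X_mem (w i)
  · refine ⟨constantCoeff (specLast f), mem_specIdeal.mpr fun w => ?_⟩
    rw [map_sub, hf, map_sub]
    have h1 : act w (C (constantCoeff (specLast f))) = C (constantCoeff (specLast f)) :=
      rename_C _ _
    rw [h1, ← algebraMap_eq, AlgHom.commutes, algebraMap_eq]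
    exact sub_C_mem_symIdeal fun u => by rw [← specLast_act_extPerm, hf]
  · rw [act_prod_erase]
    generalize w i = k
    rw [map_prod]
    induction k using Fin.lastCases with
    | last =>
      have : ∏ j ∈ univ.erase (Fin.last n), specLast (X (j, 1)) =
          ∏ j : Fin n, (X (j, 1) : PolyXY n) := by
        rw [← Finset.compl_singleton, ← Fin.image_castSucc,
          Finset.prod_image fun _ _ _ _ h => Fin.castSucc_injective n h]
        simp only [specLast_X_castSucc]
      rw [this]
      exact prod_mem_symIdeal hn
    | cast k =>
      rw [Finset.prod_eq_zero (i := Fin.last n)]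
      · exact zero_mem _
      · exact Finset.mem_erase.mpr ⟨(Fin.castSucc_lt_last k).ne', Finset.mem_univ _⟩
      · exact specLast_X_last_one

end Extension

/-! ### Functionals with independent translates, and their induction from n to n + 1 points -/

section Functionals

/-- The transposition of the first two indices, if there are at least two of them. -/
def firstSwap (n : ℕ) : Equiv.Perm (Fin n) :=
  if h : 2 ≤ n then Equiv.swap ⟨0, by omega⟩ ⟨1, by omega⟩ else 1

/-- The translates of the linear functionals `ℓ i` on polynomials are as independent as possible
subject to the condition that all but the first are anti-invariant under the transposition of the
first two indices. -/
structure IsCoinvariantDualBasis (n : ℕ) {m : ℕ} (I : Ideal (PolyXY n))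
    (ℓ : Fin m → PolyXY n →ₗ[ℂ] ℂ) : Prop where
  vanish : ∀ i, ∀ f ∈ I, ℓ i f = 0
  anti : ∀ i : Fin m, (i : ℕ) ≠ 0 → ∀ f, ℓ i (act (firstSwap n) f) = -ℓ i f
  surj : ∀ h : Fin m → Equiv.Perm (Fin n) → ℂ,
    (∀ i : Fin m, (i : ℕ) ≠ 0 → ∀ w, h i (w * firstSwap n) = -h i w) →
    ∃ f, ∀ i w, ℓ i (act w⁻¹ f) = h i w

lemma firstSwap_of_two_le (n : ℕ) : firstSwap (n + 2) = Equiv.swap 0 1 := by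
  rw [firstSwap, dif_pos (by omega)]; rfl

lemma extPerm_firstSwap {n : ℕ} (hn : 2 ≤ n) : extPerm (firstSwap n) = firstSwap (n + 1) := by
  obtain ⟨k, rfl⟩ := Nat.exists_eq_add_of_le' hn
  have h1 : firstSwap (k + 2 + 1) = Equiv.swap 0 1 := firstSwap_of_two_le (k + 1)
  rw [firstSwap_of_two_le, h1]
  refine Equiv.ext fun i => ?_
  induction i using Fin.lastCases with
  | last =>
    rw [extPerm_last, Equiv.swap_apply_of_ne_of_ne] <;>
    simp [Fin.ext_iff]
  | cast i =>
    rw [extPerm_castSucc, ← (Fin.castSucc_injective (k + 2)).swap_apply]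
    rfl

lemma isCoinvariantDualBasis_one :
    IsCoinvariantDualBasis 1 (symIdeal 1)
      (fun _ : Fin 1 => (aeval (fun _ => (0 : ℂ)) : PolyXY 1 →ₐ[ℂ] ℂ).toLinearMap) := by
  refine ⟨fun _ f hf => ?_, fun i hi => absurd (by omega) hi, fun h _ => ?_⟩
  · have : symIdeal 1 ≤ RingHom.ker (aeval (fun _ => (0 : ℂ)) : PolyXY 1 →ₐ[ℂ] ℂ) := by
      refine symIdeal_le_iff.mpr ⟨fun i => by simp [RingHom.mem_ker], fun f _ h0 => ?_⟩
      rw [RingHom.mem_ker]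
      exact (aeval_zero' f).trans (by rw [h0, map_zero])
    exact this hf
  · refine ⟨C (h 0 1), fun i w => ?_⟩
    rw [Subsingleton.elim i 0, Subsingleton.elim w 1]
    simp

variable {n : ℕ}

/-- Induction of functionals along the inclusion of the permutations that fix the last index. -/
lemma exists_specLast_eq {m : ℕ} {ℓ : Fin m → PolyXY n →ₗ[ℂ] ℂ} (hm : m ≤ n)
    (hℓ : IsCoinvariantDualBasis n (symIdeal n) ℓ)
    (h : Fin m → Equiv.Perm (Fin (n + 1)) → ℂ)
    (hh : ∀ i : Fin m, (i : ℕ) ≠ 0 → ∀ w, h i (w * firstSwap (n + 1)) = -h i w) :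
    ∃ f, ∀ i w, ℓ i (specLast (act w⁻¹ f)) = h i w := by
  have hg : ∀ c : Fin (n + 1), ∃ g : PolyXY (n + 1), ∀ i u,
      ℓ i (act u⁻¹ (specLast g)) = h i (Equiv.swap c (Fin.last n) * extPerm u) := by
    intro c
    obtain ⟨f, hf⟩ := hℓ.surj (fun i u => h i (Equiv.swap c (Fin.last n) * extPerm u))
      fun i hi w => by
        -- A nonzero index below m ≤ n forces 2 ≤ n, so extending permutations preserves the first
        -- transposition.
        have := i.2
        rw [map_mul, extPerm_firstSwap (by omega), ← mul_assoc, hh i hi]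
    obtain ⟨g, rfl⟩ := specLast_surjective f
    exact ⟨g, hf⟩
  choose g hg using hg
  -- One summand per coset, indexed by the image c of the last index; the power of x makes the
  -- summand c invisible on all other cosets.
  refine ⟨∑ c, act (Equiv.swap c (Fin.last n)) (g c * X (Fin.last n, 0) ^ n), fun i w => ?_⟩
  rw [map_sum, map_sum, map_sum, Finset.sum_eq_single (w (Fin.last n))]
  · set c := w (Fin.last n) with hc
    obtain ⟨u, hu⟩ := exists_extPerm_eq (Equiv.swap c (Fin.last n) * w) (by
      rw [Equiv.Perm.mul_apply, ← hc, Equiv.swap_apply_left])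
    have hw : w = Equiv.swap c (Fin.last n) * extPerm u := by
      rw [hu, ← mul_assoc, Equiv.swap_mul_self, one_mul]
    have hw' : w⁻¹ * Equiv.swap c (Fin.last n) = extPerm u⁻¹ := by
      rw [map_inv, hu, mul_inv_rev, Equiv.swap_inv]
    rw [← act_mul_apply, hw', specLast_act_extPerm, map_mul, map_pow, specLast_X_last_zero, one_pow,
      mul_one, hg, ← hw]
  · intro c _ hc
    refine hℓ.vanish i _ ?_
    rw [← act_mul_apply, map_mul, map_mul]
    refine Ideal.mul_mem_left _ _ (specLast_act_pow_mem fun h => hc ?_)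
    rw [Equiv.Perm.mul_apply, Equiv.swap_apply_right, Equiv.Perm.inv_eq_iff_eq] at h
    exact h
  · simp

/-- The functionals on the coinvariant algebra obtained by degenerating the ones induced from one
point less. -/
lemma exists_functionals_vanishing_on_facetIdeal (hn : 1 ≤ n) {ℓ : Fin n → PolyXY n →ₗ[ℂ] ℂ}
    (hℓ : IsCoinvariantDualBasis n (symIdeal n) ℓ) :
    ∃ ℓ' : Fin n → PolyXY (n + 1) →ₗ[ℂ] ℂ,
      IsCoinvariantDualBasis (n + 1) (symIdeal (n + 1) ⊔ facetIdeal (n + 1)) ℓ' := by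
  set I := symIdeal (n + 1) ⊔ facetIdeal (n + 1) with hI
  have hfin : FiniteDimensional ℂ (PolyXY (n + 1) ⧸ I) := by
    refine finiteDimensional_of_colength_ne_top
      (ne_top_of_le_ne_top (ne_top_of_two_mul_le (two_mul_colength_symIdeal_le (n := n + 1)
        (by omega))) (colength_antitone le_sup_left))
  have hinv : ∀ g, ∀ f ∈ I, act g f ∈ I := by
    intro g f hf
    obtain ⟨a, ha, b, hb, rfl⟩ := Submodule.mem_sup.mp hf
    rw [map_add]
    exact Submodule.add_mem_sup (act_mem_symIdeal g ha) (act_mem_facetIdeal g hb)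
  have : FiniteDimensional ℂ (PolyXY (n + 1) ⧸ I.restrictScalars ℂ) := hfin
  obtain ⟨s, hs0, hs1, hs2, hs3⟩ := exists_equivariant_filtered_section (polyRep (n + 1))
    (degLT _) degLT_mono degLT_zero (I.restrictScalars ℂ)
    (fun g d f hf => act_mem_degLT g hf) hinv
  refine ⟨fun i => ℓ i ∘ₗ specLast.toLinearMap ∘ₗ s, fun i f hf => ?_, fun i hi f => ?_,
    fun h hh => ?_⟩
  · simp [hs1 f hf]
  · have := i.2
    change ℓ i (specLast (s (polyRep (n + 1) (firstSwap (n + 1)) f))) = -ℓ i (specLast (s f))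
    rw [hs0, polyRep_apply, ← extPerm_firstSwap (by omega), specLast_act_extPerm, hℓ.anti i hi]
  · let φ : PolyXY (n + 1) →ₗ[ℂ] (Fin n → Equiv.Perm (Fin (n + 1)) → ℂ) :=
      LinearMap.pi fun i => LinearMap.pi fun w =>
        ℓ i ∘ₗ specLast.toLinearMap ∘ₗ (act w⁻¹).toLinearMap
    obtain ⟨f, hf⟩ := exists_specLast_eq le_rfl hℓ h hh
    obtain ⟨d, hd⟩ := exists_mem_degLT f
    -- An element of I agrees in its top degree with an element of `specIdeal n`, on which φ
    -- vanishes; so φ of it is φ of something of lower degree.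
    obtain ⟨r, -, hr⟩ := exists_apply_section_eq degLT_mono degLT_zero hs2 hs3 φ (by
      intro d f hf hfd
      obtain ⟨b, hb, hfb⟩ := exists_sub_mem_of_mem_leadIdeal (symIdeal_sup_facetIdeal_le hn hf) hfd
      refine ⟨b, hb, ?_⟩
      rw [← sub_eq_zero, ← map_sub]
      funext i w
      exact hℓ.vanish i _ (mem_specIdeal.mp hfb w⁻¹)) d f hd
    refine ⟨r, fun i w => ?_⟩
    have h1 : s (act w⁻¹ r) = act w⁻¹ (s r) := hs0 w⁻¹ r
    have h2 := congrFun (congrFun hr i) w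
    change ℓ i (specLast (s (act w⁻¹ r))) = h i w
    rw [h1, ← hf i w]
    exact h2

end Functionals

/-! ### Functions on the symmetric group twisted by the first transposition -/

/-- The functions on the symmetric group that are multiplied by `c` under right translation by the
transposition of the first two indices. -/
def twistedFunctions (n : ℕ) (c : ℂ) : Submodule ℂ (Equiv.Perm (Fin n) → ℂ) where
  carrier := {h | ∀ w, h (w * firstSwap n) = c * h w}
  add_mem' {a b} ha hb w := by rw [Pi.add_apply, Pi.add_apply, ha, hb, mul_add]
  zero_mem' w := by simp
  smul_mem' r h hh w := by rw [Pi.smul_apply, Pi.smul_apply, hh, smul_eq_mul, smul_eq_mul]; ring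

lemma firstSwap_mul_self (n : ℕ) : firstSwap n * firstSwap n = 1 := by
  rw [firstSwap]
  split_ifs
  · exact Equiv.swap_mul_self _ _
  · exact one_mul 1

lemma mul_firstSwap_mul_firstSwap {n : ℕ} (w : Equiv.Perm (Fin n)) :
    w * firstSwap n * firstSwap n = w := by
  rw [mul_assoc, firstSwap_mul_self, mul_one]

lemma sign_firstSwap {n : ℕ} (hn : 2 ≤ n) : Equiv.Perm.sign (firstSwap n) = -1 := by
  rw [firstSwap, dif_pos hn, Equiv.Perm.sign_swap]
  simp

/-- A function is determined by its c- and (-c)-eigenparts under right translation by the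
transposition, and multiplying by the sign character turns the second into a c-eigenfunction. -/
lemma factorial_le_two_mul_finrank_twistedFunctions {n : ℕ} (hn : 2 ≤ n) {c : ℂ} (hc : c * c = 1) :
    n.factorial ≤ 2 * Module.finrank ℂ (twistedFunctions n c) := by
  let sgn : Equiv.Perm (Fin n) → ℂ := fun w => ((Equiv.Perm.sign w : ℤ) : ℂ)
  have hsgn : ∀ w, sgn (w * firstSwap n) = -sgn w := fun w => by
    simp [sgn, sign_firstSwap hn]
  have hsgn0 : ∀ w, sgn w ≠ 0 := fun w => by simp [sgn]
  let T : (Equiv.Perm (Fin n) → ℂ) →ₗ[ℂ] (Equiv.Perm (Fin n) → ℂ) :=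
    LinearMap.funLeft ℂ ℂ fun w => w * firstSwap n
  have hT : ∀ h w, T h w = h (w * firstSwap n) := fun h w => rfl
  let a : (Equiv.Perm (Fin n) → ℂ) →ₗ[ℂ] twistedFunctions n c :=
    (LinearMap.id + c • T).codRestrict _ fun h w => by
      simp only [LinearMap.add_apply, LinearMap.id_apply, LinearMap.smul_apply, Pi.add_apply,
        Pi.smul_apply, hT, mul_firstSwap_mul_firstSwap, smul_eq_mul]
      linear_combination (-h (w * firstSwap n)) * hc
  let b : (Equiv.Perm (Fin n) → ℂ) →ₗ[ℂ] twistedFunctions n c :=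
    (LinearMap.mulLeft ℂ sgn ∘ₗ (LinearMap.id - c • T)).codRestrict _ fun h w => by
      simp only [LinearMap.comp_apply, LinearMap.mulLeft_apply, Pi.mul_apply, LinearMap.sub_apply,
        LinearMap.id_apply, LinearMap.smul_apply, Pi.sub_apply, Pi.smul_apply, hT,
        mul_firstSwap_mul_firstSwap, smul_eq_mul, hsgn]
      linear_combination (sgn w * h (w * firstSwap n)) * hc
  have hinj : Function.Injective (a.prod b) := by
    refine (injective_iff_map_eq_zero _).mpr fun h hh => ?_
    have h1 : (a h : Equiv.Perm (Fin n) → ℂ) = 0 := congrArg (fun p => p.1.1) hh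
    have h2 : (b h : Equiv.Perm (Fin n) → ℂ) = 0 := congrArg (fun p => p.2.1) hh
    funext w
    have h3 : h w + c * h (w * firstSwap n) = 0 := congrFun h1 w
    have h4 : sgn w * (h w - c * h (w * firstSwap n)) = 0 := congrFun h2 w
    have h5 := (mul_eq_zero.mp h4).resolve_left (hsgn0 w)
    change h w = 0
    linear_combination (h3 + h5) / 2
  have := LinearMap.finrank_le_finrank_of_injective hinj
  rw [Module.finrank_prod, Module.finrank_fintype_fun_eq_card, Fintype.card_perm,
    Fintype.card_fin] at this
  omega

lemma homCore_mono {σ : Type*} {K K' : Ideal (MvPolynomial σ ℂ)} (h : K ≤ K') :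
    homCore K ≤ homCore K' := fun _ hf e => h (hf e)

/-! ### The new functional: a tangent vector at two colliding points -/

section DualEval

variable {m : ℕ}

/-- Coordinates that coincide for the first two indices and are distinct otherwise. -/
def collidingCoord (i : Fin (m + 2)) : ℂ := ((i : ℕ) - 1 : ℕ)

/-- A tangent vector in which the first two points move apart. -/
def separatingDir (i : Fin (m + 2)) : ℂ := if i = 0 then 1 else if i = 1 then -1 else 0

/-- Evaluation at the tangent vector `separatingDir` to the configuration `collidingCoord` of
points on the `y`-axis. -/
def dualEval : PolyXY (m + 2) →ₐ[ℂ] DualNumber ℂ :=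
  aeval fun p => if p.2 = 0 then 0 else
    TrivSqZeroExt.inl (collidingCoord p.1) + TrivSqZeroExt.inr (separatingDir p.1)

@[simp]
lemma dualEval_X_zero (i : Fin (m + 2)) : dualEval (X (i, 0)) = 0 := by
  rw [dualEval, aeval_X]; simp

@[simp]
lemma dualEval_X_one (i : Fin (m + 2)) : dualEval (X (i, 1)) =
    TrivSqZeroExt.inl (collidingCoord i) + TrivSqZeroExt.inr (separatingDir i) := by
  rw [dualEval, aeval_X]; simp

lemma collidingCoord_firstSwap (i : Fin (m + 2)) :
    collidingCoord (firstSwap (m + 2) i) = collidingCoord i := by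
  rw [firstSwap_of_two_le, Equiv.swap_apply_def]
  split_ifs with h1 h2
  · rw [h1]; simp [collidingCoord]
  · rw [h2]; simp [collidingCoord]
  · rfl

lemma separatingDir_firstSwap (i : Fin (m + 2)) :
    separatingDir (firstSwap (m + 2) i) = -separatingDir i := by
  rw [firstSwap_of_two_le, Equiv.swap_apply_def]
  split_ifs with h1 h2
  · rw [h1]; simp [separatingDir]
  · rw [h2]; simp [separatingDir]
  · simp [separatingDir, h1, h2]

lemma dualEval_act_firstSwap (f : PolyXY (m + 2)) :
    (dualEval (act (firstSwap (m + 2)) f)).fst = (dualEval f).fst ∧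
      (dualEval (act (firstSwap (m + 2)) f)).snd = -(dualEval f).snd := by
  have h : (dualEval.comp (act (firstSwap (m + 2))) : PolyXY (m + 2) →ₐ[ℂ] DualNumber ℂ) =
      (TrivSqZeroExt.map (-LinearMap.id : ℂ →ₗ[ℂ] ℂ)).comp dualEval := by
    ext ⟨i, b⟩ : 1
    fin_cases b
    · simp
    · ext <;> simp [collidingCoord_firstSwap, separatingDir_firstSwap, -DualNumber.inr_eq_smul_eps]
  have h1 := DFunLike.congr_fun h f
  change dualEval (act _ f) = TrivSqZeroExt.map _ (dualEval f) at h1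
  rw [h1]
  exact ⟨TrivSqZeroExt.fst_map _ _, by rw [TrivSqZeroExt.snd_map]; rfl⟩

variable (m) in
/-- The polynomials that vanish at all translates of the tangent vector of `dualEval`. -/
def tangentIdeal : Ideal (PolyXY (m + 2)) :=
  ⨅ w : Equiv.Perm (Fin (m + 2)), (⊥ : Ideal (DualNumber ℂ)).comap (dualEval.comp (act w))

variable (m) in
/-- The polynomials that vanish at all translates of the base point of `dualEval`. -/
def pointIdeal : Ideal (PolyXY (m + 2)) :=
  ⨅ w : Equiv.Perm (Fin (m + 2)), (⊥ : Ideal ℂ).comap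
    ((TrivSqZeroExt.fstHom ℂ ℂ ℂ).comp (dualEval.comp (act w)))

lemma mem_tangentIdeal {f : PolyXY (m + 2)} :
    f ∈ tangentIdeal m ↔ ∀ w, dualEval (act w f) = 0 := by
  simp [tangentIdeal, Ideal.mem_comap]

lemma mem_pointIdeal {f : PolyXY (m + 2)} :
    f ∈ pointIdeal m ↔ ∀ w, (dualEval (act w f)).fst = 0 := by
  simp [pointIdeal, Ideal.mem_comap]

lemma tangentIdeal_le_pointIdeal : tangentIdeal m ≤ pointIdeal m := fun f hf =>
  mem_pointIdeal.mpr fun w => by rw [mem_tangentIdeal.mp hf w]; rfl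

variable (m) in
/-- The coinvariant ideal together with the variables `xᵢ`. -/
def symIdealX : Ideal (PolyXY (m + 2)) :=
  symIdeal (m + 2) ⊔ Ideal.span (Set.range fun i => X (i, 0))

lemma X_zero_mem_tangentIdeal (i : Fin (m + 2)) : X (i, 0) ∈ tangentIdeal m :=
  mem_tangentIdeal.mpr fun w => by rw [act_X, dualEval_X_zero]

/-- The transposition fixes the base point and reverses the tangent vector, so the derivative of a
symmetric polynomial along it vanishes: only a constant remains. -/
lemma symIdealX_le_leadIdeal : symIdealX m ≤ leadIdeal (tangentIdeal m) := by
  refine sup_le (symIdeal_le_leadIdeal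
    (fun i => Ideal.mul_mem_right _ _ (X_zero_mem_tangentIdeal i)) fun f hf => ?_)
    (Ideal.span_le.mpr ?_)
  · refine ⟨(dualEval f).fst, mem_tangentIdeal.mpr fun w => ?_⟩
    have h1 : act w (C (dualEval f).fst) = C (dualEval f).fst := rename_C _ _
    rw [map_sub, hf, h1, map_sub, ← algebraMap_eq, AlgHom.commutes]
    have h2 := (dualEval_act_firstSwap f).2
    rw [hf] at h2
    have h3 : (dualEval f).snd = 0 := by linear_combination h2 / 2
    rw [TrivSqZeroExt.algebraMap_eq_inl]
    ext
    · simp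
    · simp [h3]
  · rintro _ ⟨i, rfl⟩
    exact homCore_le_leadIdeal _ (mem_homCore_of_isHomogeneous (isHomogeneous_X ℂ _)
      (X_zero_mem_tangentIdeal i))

lemma symIdealX_le_homCore : symIdealX m ≤ homCore (symIdealX m) := by
  refine sup_le (symIdeal_le_homCore.trans (homCore_mono le_sup_left)) (Ideal.span_le.mpr ?_)
  rintro _ ⟨i, rfl⟩
  exact mem_homCore_of_isHomogeneous (isHomogeneous_X ℂ _)
    (Ideal.mem_sup_right (Ideal.subset_span ⟨i, rfl⟩))

/-- Both colliding points have y = 0, and omitting one factor leaves at least one of them. -/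
lemma fst_dualEval_prod_erase (i : Fin (m + 2)) :
    (dualEval (∏ j ∈ univ.erase i, X (j, 1))).fst = 0 := by
  change (TrivSqZeroExt.fstHom ℂ ℂ ℂ) (dualEval (∏ j ∈ univ.erase i, X (j, 1))) = 0
  rw [map_prod, map_prod]
  by_cases hi : i = 0
  · refine Finset.prod_eq_zero (i := 1) (by simp [hi]) ?_
    simp [collidingCoord]
  · refine Finset.prod_eq_zero (i := 0) (by simp [Ne.symm hi]) ?_
    simp [collidingCoord]

lemma facetIdeal_le_homCore_pointIdeal : facetIdeal (m + 2) ≤ homCore (pointIdeal m) :=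
  facetIdeal_le_homCore fun i => mem_pointIdeal.mpr fun w => by
    rw [act_prod_erase]; exact fst_dualEval_prod_erase _

lemma homCore_le {σ : Type*} (K : Ideal (MvPolynomial σ ℂ)) : homCore K ≤ K := fun f hf => by
  rw [← sum_homogeneousComponent f]
  exact sum_mem fun e _ => hf e

lemma facetIdeal_le_pointIdeal : facetIdeal (m + 2) ≤ pointIdeal m :=
  facetIdeal_le_homCore_pointIdeal.trans (homCore_le _)

lemma symIdealX_sup_facetIdeal_le :
    symIdealX m ⊔ facetIdeal (m + 2) ≤ leadIdeal (pointIdeal m) :=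
  sup_le (symIdealX_le_leadIdeal.trans (leadIdeal_mono tangentIdeal_le_pointIdeal))
    (facetIdeal_le_homCore_pointIdeal.trans (homCore_le_leadIdeal _))

lemma symIdealX_sup_facetIdeal_le_homCore :
    symIdealX m ⊔ facetIdeal (m + 2) ≤ homCore (symIdealX m ⊔ facetIdeal (m + 2)) :=
  sup_le (symIdealX_le_homCore.trans (homCore_mono le_sup_left))
    ((facetIdeal_le_homCore prod_erase_mem_facetIdeal).trans (homCore_mono le_sup_right))

/-- The bound (m + 2)!/2 is the number of distinct translates of the base point, which makes the
dimension count in `mem_sup_degLT_of_mem_pointIdeal` sharp. -/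
lemma two_mul_colength_symIdealX_sup_facetIdeal_le :
    2 * colength (symIdealX m ⊔ facetIdeal (m + 2)) ≤ ((m + 2).factorial : ℕ) := by
  refine (PsumMem.two_mul_colength_le (z := fun i => X (i, 1)) m (P := univ) (by simp)
    ⟨by simp, fun k hk => ?_⟩ fun u _ => ?_).trans ?_
  · exact Ideal.mem_sup_left (Ideal.mem_sup_left (psum_mem_symIdeal 1 k hk))
  · exact Ideal.mem_sup_right (prod_erase_mem_facetIdeal u)
  · refine (mul_le_mul_right ((colength_antitone ?_).trans colength_variables_le) _).trans
      (mul_one _).le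
    exact sup_le_sup (le_sup_right.trans le_sup_left) le_rfl

lemma collidingCoord_eq_iff {i j : Fin (m + 2)} : collidingCoord i = collidingCoord j ↔
    i = j ∨ (i = 0 ∧ j = 1) ∨ (i = 1 ∧ j = 0) := by
  simp only [collidingCoord, Nat.cast_inj, Fin.ext_iff, Fin.val_zero, Fin.val_one]
  omega

lemma eq_or_eq_firstSwap {u : Equiv.Perm (Fin (m + 2))}
    (h : ∀ i, collidingCoord (u i) = collidingCoord i) : u = 1 ∨ u = firstSwap (m + 2) := by
  have h01 : (0 : Fin (m + 2)) ≠ 1 := by simp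
  have hfix : ∀ i, i ≠ 0 → i ≠ 1 → u i = i := fun i h0 h1 => by
    rcases collidingCoord_eq_iff.mp (h i) with h | h | h
    · exact h
    · exact absurd h.2 h1
    · exact absurd h.2 h0
  rw [firstSwap_of_two_le]
  by_cases hu : u 0 = 0
  · left
    have hu1 : u 1 = 1 := by
      rcases collidingCoord_eq_iff.mp (h 1) with h | h | h
      · exact h
      · exact absurd (u.injective (hu.trans h.1.symm)) h01
      · exact h.1
    refine Equiv.ext fun i => ?_
    by_cases h0 : i = 0
    · rw [h0, hu]; rfl
    by_cases h1 : i = 1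
    · rw [h1, hu1]; rfl
    · exact hfix i h0 h1
  · right
    have hu0 : u 0 = 1 := by
      rcases collidingCoord_eq_iff.mp (h 0) with h | h | h
      · exact absurd h hu
      · exact absurd h.1 hu
      · exact h.1
    have hu1 : u 1 = 0 := by
      rcases collidingCoord_eq_iff.mp (h 1) with h | h | h
      · exact absurd (u.injective (hu0.trans h.symm)) h01
      · exact h.1
      · exact absurd h.2.symm h01
    refine Equiv.ext fun i => ?_
    by_cases h0 : i = 0
    · rw [h0, hu0, Equiv.swap_apply_left]
    by_cases h1 : i = 1
    · rw [h1, hu1, Equiv.swap_apply_right]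
    · rw [Equiv.swap_apply_of_ne_of_ne h0 h1, hfix i h0 h1]

/-- Lagrange interpolation: the translates of the base point are distinct except that w and w ·
`firstSwap` give the same one, so every other translate is separated from that of w₀ by some
coordinate. -/
lemma exists_fst_dualEval_eq_ite (w₀ : Equiv.Perm (Fin (m + 2))) :
    ∃ g, ∀ w, (dualEval (act w⁻¹ g)).fst =
      if w = w₀ ∨ w = w₀ * firstSwap (m + 2) then 1 else 0 := by
  classical
  set s := firstSwap (m + 2) with hs
  have hsep : ∀ w, ¬(w = w₀ ∨ w = w₀ * s) →
      ∃ i, collidingCoord (w⁻¹ i) ≠ collidingCoord (w₀⁻¹ i) := by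
    intro w hw
    by_contra! hcon
    refine hw ?_
    rcases eq_or_eq_firstSwap (u := w⁻¹ * w₀) (fun i => by
      rw [Equiv.Perm.mul_apply, hcon, ← Equiv.Perm.mul_apply, inv_mul_cancel, Equiv.Perm.one_apply]) with h | h
    · left
      exact inv_mul_eq_one.mp h
    · right
      rw [inv_mul_eq_iff_eq_mul.mp h, hs, mul_firstSwap_mul_firstSwap]
  choose! i hi using hsep
  let S : Finset (Equiv.Perm (Fin (m + 2))) := univ.filter fun w => ¬(w = w₀ ∨ w = w₀ * s)
  let g : PolyXY (m + 2) := ∏ v ∈ S, (X (i v, 1) - C (collidingCoord (v⁻¹ (i v))))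
  have hg : ∀ w, (dualEval (act w⁻¹ g)).fst =
      ∏ v ∈ S, (collidingCoord (w⁻¹ (i v)) - collidingCoord (v⁻¹ (i v))) := by
    intro w
    change (TrivSqZeroExt.fstHom ℂ ℂ ℂ) (dualEval (act w⁻¹ g)) = _
    rw [map_prod, map_prod, map_prod]
    refine Finset.prod_congr rfl fun v _ => ?_
    have h1 : act w⁻¹ (C (collidingCoord (v⁻¹ (i v)))) = C (collidingCoord (v⁻¹ (i v))) :=
      rename_C _ _
    rw [map_sub, h1, act_X, map_sub, map_sub, dualEval_X_one, ← algebraMap_eq, AlgHom.commutes]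
    simp
  set c := (dualEval (act w₀⁻¹ g)).fst with hc
  have hc0 : c ≠ 0 := by
    rw [hc, hg, Finset.prod_ne_zero_iff]
    intro v hv
    exact sub_ne_zero.mpr (hi v (Finset.mem_filter.mp hv).2).symm
  refine ⟨c⁻¹ • g, fun w => ?_⟩
  rw [map_smul, map_smul, TrivSqZeroExt.fst_smul, smul_eq_mul]
  split_ifs with hw
  · rcases hw with rfl | rfl
    · exact inv_mul_cancel₀ hc0
    · rw [mul_inv_rev, inv_eq_of_mul_eq_one_left (firstSwap_mul_self (m + 2)), act_mul_apply,
        (dualEval_act_firstSwap _).1]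
      exact inv_mul_cancel₀ hc0
  · rw [hg, Finset.prod_eq_zero (i := w), mul_zero]
    · exact Finset.mem_filter.mpr ⟨Finset.mem_univ _, hw⟩
    · exact sub_self _

lemma sum_ite_firstSwap (a : Equiv.Perm (Fin (m + 2)) → ℂ) (w : Equiv.Perm (Fin (m + 2))) :
    ∑ w₀, a w₀ * (if w = w₀ ∨ w = w₀ * firstSwap (m + 2) then 1 else 0) =
      a w + a (w * firstSwap (m + 2)) := by
  classical
  have hne : w ≠ w * firstSwap (m + 2) := by
    intro h
    have h1 := sign_firstSwap (n := m + 2) (by omega)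
    rw [left_eq_mul.mp h, map_one] at h1
    exact absurd h1 (by decide)
  rw [← Finset.sum_subset (Finset.subset_univ {w, w * firstSwap (m + 2)})]
  · rw [Finset.sum_pair hne, if_pos (Or.inl rfl), if_pos (Or.inr ?_), mul_one, mul_one]
    rw [mul_firstSwap_mul_firstSwap]
  · intro v _ hv
    rw [if_neg, mul_zero]
    rintro (rfl | rfl)
    · simp at hv
    · rw [mul_firstSwap_mul_firstSwap] at hv
      simp at hv

/-- Evaluation at the translates of the base point of `dualEval`. -/
def pointEval : PolyXY (m + 2) →ₗ[ℂ] twistedFunctions (m + 2) 1 :=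
  (LinearMap.pi fun w => (TrivSqZeroExt.fstHom ℂ ℂ ℂ).toLinearMap ∘ₗ dualEval.toLinearMap ∘ₗ
    (act w⁻¹).toLinearMap).codRestrict _ fun f w => by
      change (dualEval (act (w * firstSwap (m + 2))⁻¹ f)).fst = 1 * (dualEval (act w⁻¹ f)).fst
      rw [mul_inv_rev, inv_eq_of_mul_eq_one_left (firstSwap_mul_self (m + 2)), act_mul_apply,
        (dualEval_act_firstSwap _).1, one_mul]

lemma pointEval_apply (f : PolyXY (m + 2)) (w : Equiv.Perm (Fin (m + 2))) :
    (pointEval f).1 w = (dualEval (act w⁻¹ f)).fst := rfl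

lemma pointEval_surjective : Function.Surjective (pointEval (m := m)) := by
  intro h
  choose g hg using exists_fst_dualEval_eq_ite (m := m)
  refine ⟨∑ w₀, (h.1 w₀ / 2) • g w₀, Subtype.ext (funext fun w => ?_)⟩
  rw [pointEval_apply]
  change (TrivSqZeroExt.fstHom ℂ ℂ ℂ) _ = _
  simp only [map_sum, map_smul]
  change ∑ w₀, (h.1 w₀ / 2) • (dualEval (act w⁻¹ (g w₀))).fst = _
  simp only [hg, smul_eq_mul]
  rw [sum_ite_firstSwap (fun w => h.1 w / 2), h.2 w]
  ring

lemma pointEval_eq_zero {f : PolyXY (m + 2)} (hf : f ∈ pointIdeal m) : pointEval f = 0 :=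
  Subtype.ext (funext fun w => mem_pointIdeal.mp hf w⁻¹)

/-- Converse of `symIdealX_sup_facetIdeal_le`: evaluation at the translates has rank at least (m +
2)!/2, the bound for the colength, so the ideal of the points has no further leading forms. -/
lemma mem_sup_degLT_of_mem_pointIdeal {d : ℕ} {f : PolyXY (m + 2)} (hf : f ∈ pointIdeal m)
    (hfd : f ∈ degLT _ (d + 1)) :
    f ∈ (symIdealX m ⊔ facetIdeal (m + 2)).restrictScalars ℂ ⊔ degLT _ d := by
  set I := symIdealX m ⊔ facetIdeal (m + 2) with hI
  have hle := two_mul_colength_symIdealX_sup_facetIdeal_le (m := m)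
  have hfin : FiniteDimensional ℂ (PolyXY (m + 2) ⧸ I) :=
    finiteDimensional_of_colength_ne_top (ne_top_of_two_mul_le hle)
  have hrank : 2 * Module.finrank ℂ (PolyXY (m + 2) ⧸ I) ≤ (m + 2).factorial :=
    finrank_le_of_two_mul_colength_le hle
  have : FiniteDimensional ℂ (PolyXY (m + 2) ⧸ I.restrictScalars ℂ) := hfin
  refine mem_sup_of_finrank_le degLT_mono degLT_zero exists_mem_degLT pointEval
    pointEval_surjective (fun d f hf hfd => ?_) ?_ (pointEval_eq_zero hf) hfd
  · obtain ⟨b, hb, hfb⟩ :=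
      exists_sub_mem_of_mem_leadIdeal (symIdealX_sup_facetIdeal_le hf) hfd
    exact ⟨b, hb, by rw [← sub_eq_zero, ← map_sub, pointEval_eq_zero hfb]⟩
  · have h1 : 2 * Module.finrank ℂ (PolyXY (m + 2) ⧸ I.restrictScalars ℂ) ≤
        (m + 2).factorial := hrank
    have h2 := factorial_le_two_mul_finrank_twistedFunctions (n := m + 2) (c := 1) (by omega)
      (by norm_num)
    exact Nat.le_of_mul_le_mul_left (h1.trans h2) two_pos

/-- The point is the degree bound on b: in an arbitrary decomposition of g the top degrees could
cancel. As g vanishes at the points, its leading form splits into a part in `symIdealX m`, which is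
the leading form of an element of `tangentIdeal m`, and a part in the facet ideal; both are removed
and the degree drops. -/
lemma exists_sub_mem_tangentIdeal (e : ℕ) : ∀ g ∈ tangentIdeal m ⊔ facetIdeal (m + 2),
    g ∈ degLT _ e → ∃ b ∈ facetIdeal (m + 2), b ∈ degLT _ e ∧ g - b ∈ tangentIdeal m := by
  induction e with
  | zero =>
    intro g _ hg
    rw [degLT_zero, Submodule.mem_bot] at hg
    exact ⟨0, zero_mem _, zero_mem _, by simp [hg]⟩
  | succ e ih =>
    intro g hg hge
    have hg' : g ∈ pointIdeal m :=
      (sup_le tangentIdeal_le_pointIdeal facetIdeal_le_pointIdeal) hg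
    obtain ⟨a, ha, l, hl, hal⟩ := Submodule.mem_sup.mp (mem_sup_degLT_of_mem_pointIdeal hg' hge)
    have h1 : homogeneousComponent e g ∈ symIdealX m ⊔ facetIdeal (m + 2) := by
      rw [← hal, map_add, hl e le_rfl, add_zero]
      exact symIdealX_sup_facetIdeal_le_homCore ha e
    obtain ⟨k, hk, b, hb, hkb⟩ := Submodule.mem_sup.mp h1
    have hk' := symIdealX_le_homCore hk e
    have hb' := facetIdeal_le_homCore prod_erase_mem_facetIdeal hb e
    have hkb' : homogeneousComponent e k + homogeneousComponent e b =
        homogeneousComponent e g := by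
      rw [← map_add, hkb, homogeneousComponent_of_mem (homogeneousComponent_isHomogeneous e g),
        if_pos rfl]
    obtain ⟨l', hl', hkl⟩ := exists_sub_mem_of_mem_leadIdeal (symIdealX_le_leadIdeal hk')
      (mem_degLT_of_isHomogeneous (homogeneousComponent_isHomogeneous e k))
    have hsub := sub_homogeneousComponent_mem_degLT hge
    obtain ⟨b₂, hb₂, hb₂e, hgb⟩ := ih (l' + (g - homogeneousComponent e g)) (by
      have : l' + (g - homogeneousComponent e g) =
          g - (homogeneousComponent e k - l') - homogeneousComponent e b := by
        rw [← hkb']; ring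
      rw [this]
      exact sub_mem (sub_mem hg (Ideal.mem_sup_left hkl)) (Ideal.mem_sup_right hb'))
      (add_mem hl' hsub)
    refine ⟨b₂ + homogeneousComponent e b, add_mem hb₂ hb', add_mem (degLT_mono (Nat.le_succ e) hb₂e)
      (mem_degLT_of_isHomogeneous (homogeneousComponent_isHomogeneous e b)), ?_⟩
    have : g - (b₂ + homogeneousComponent e b) =
        (l' + (g - homogeneousComponent e g) - b₂) + (homogeneousComponent e k - l') := by
      rw [← hkb']; ring
    rw [this]
    exact add_mem hgb hkl

/-- The derivatives at the translates of the tangent vector of `dualEval`. -/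
def tangentEval : PolyXY (m + 2) →ₗ[ℂ] (Equiv.Perm (Fin (m + 2)) → ℂ) :=
  LinearMap.pi fun w => TrivSqZeroExt.sndHom ℂ ℂ ∘ₗ dualEval.toLinearMap ∘ₗ
    (act w⁻¹).toLinearMap

lemma tangentEval_apply (f : PolyXY (m + 2)) (w : Equiv.Perm (Fin (m + 2))) :
    tangentEval f w = (dualEval (act w⁻¹ f)).snd := rfl

/-- The factor of index 0 is the infinitesimal itself, and all remaining coordinates are nonzero. -/
lemma snd_dualEval_prod_erase_ne_zero :
    (dualEval (∏ j ∈ univ.erase (1 : Fin (m + 2)), X (j, 1))).snd ≠ 0 := by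
  have h0 : (0 : Fin (m + 2)) ∈ univ.erase (1 : Fin (m + 2)) := by simp
  rw [← Finset.mul_prod_erase _ _ h0, map_mul, DualNumber.snd_mul, dualEval_X_one]
  have h1 : (dualEval (∏ j ∈ (univ.erase (1 : Fin (m + 2))).erase 0, X (j, 1))).fst ≠ 0 := by
    change (TrivSqZeroExt.fstHom ℂ ℂ ℂ) _ ≠ 0
    rw [map_prod, map_prod, Finset.prod_ne_zero_iff]
    intro j hj
    simp only [Finset.mem_erase, Finset.mem_univ, and_true] at hj
    have h2 : collidingCoord j ≠ collidingCoord (0 : Fin (m + 2)) := by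
      rw [Ne, collidingCoord_eq_iff]
      simp [hj.1, hj.2]
    simpa [collidingCoord] using h2
  simpa [collidingCoord, separatingDir] using h1

lemma exists_mem_facetIdeal_tangentEval_eq {h : Equiv.Perm (Fin (m + 2)) → ℂ}
    (hh : ∀ w, h (w * firstSwap (m + 2)) = -h w) :
    ∃ f ∈ facetIdeal (m + 2), tangentEval f = h := by
  choose g hg using exists_fst_dualEval_eq_ite (m := m)
  set Y : PolyXY (m + 2) := ∏ j ∈ univ.erase (1 : Fin (m + 2)), X (j, 1) with hY
  set κ := (dualEval Y).snd with hκ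
  have hκ0 : κ ≠ 0 := snd_dualEval_prod_erase_ne_zero
  have hYF : Y ∈ facetIdeal (m + 2) := prod_erase_mem_facetIdeal 1
  -- All translates of Y vanish at the base point, so by the product rule only the value of g w₀ and
  -- the derivative of the translate of Y matter. Both w₀ = w and w₀ = w · `firstSwap` contribute,
  -- with signs that cancel, whence the factor 2.
  refine ⟨∑ w₀, (h w₀ / (2 * κ)) • (g w₀ * act w₀ Y), sum_mem fun w₀ _ => ?_, funext fun w => ?_⟩
  · rw [smul_eq_C_mul]
    exact Ideal.mul_mem_left _ _ (Ideal.mul_mem_left _ _ (act_mem_facetIdeal _ hYF))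
  · have h1 : ∀ v, (dualEval (act w⁻¹ (act v Y))).fst = 0 := fun v => by
      rw [← act_mul_apply]
      exact mem_pointIdeal.mp (facetIdeal_le_pointIdeal hYF) _
    have h5 : ∀ v, tangentEval ((h v / (2 * κ)) • (g v * act v Y)) w = h v / (2 * κ) *
        ((dualEval (act w⁻¹ (g v))).fst * (dualEval (act w⁻¹ (act v Y))).snd) := fun v => by
      rw [map_smul, Pi.smul_apply, tangentEval_apply, map_mul, map_mul, DualNumber.snd_mul, h1,
        mul_zero, add_zero, smul_eq_mul]
    rw [map_sum, Finset.sum_apply]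
    simp only [h5, hg]
    have h2 := sum_ite_firstSwap
      (fun v => h v / (2 * κ) * (dualEval (act w⁻¹ (act v Y))).snd) w
    have h3 : (dualEval (act w⁻¹ (act w Y))).snd = κ := by
      rw [← act_mul_apply, inv_mul_cancel, act_one_apply]
    have h4 : (dualEval (act w⁻¹ (act (w * firstSwap (m + 2)) Y))).snd = -κ := by
      rw [← act_mul_apply, inv_mul_cancel_left, (dualEval_act_firstSwap _).2]
    rw [h3, h4, hh] at h2
    refine Eq.trans (Finset.sum_congr rfl fun v _ => by ring) (h2.trans ?_)
    field_simp
    ring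

variable (m) in
/-- A functional on the coinvariant algebra, anti-invariant under the transposition of the first two
indices, whose translates are as independent as possible on the facet ideal. -/
lemma exists_functional_on_facetIdeal : ∃ ℓ : PolyXY (m + 2) →ₗ[ℂ] ℂ,
    (∀ f ∈ symIdeal (m + 2), ℓ f = 0) ∧ (∀ f, ℓ (act (firstSwap (m + 2)) f) = -ℓ f) ∧
      ∀ h : Equiv.Perm (Fin (m + 2)) → ℂ, (∀ w, h (w * firstSwap (m + 2)) = -h w) →
        ∃ f ∈ facetIdeal (m + 2), ∀ w, ℓ (act w⁻¹ f) = h w := by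
  -- The filtration exhausts only the facet ideal, so the section maps that ideal to itself and the
  -- corrections in `exists_apply_section_eq` stay inside it.
  let V : ℕ → Submodule ℂ (PolyXY (m + 2)) := fun d =>
    (facetIdeal (m + 2)).restrictScalars ℂ ⊓ degLT _ d
  have hV : Monotone V := fun _ _ h => inf_le_inf_left _ (degLT_mono h)
  have hV0 : V 0 = ⊥ := by simp only [V, degLT_zero, inf_bot_eq]
  have hfin : FiniteDimensional ℂ (PolyXY (m + 2) ⧸ symIdeal (m + 2)) :=
    finiteDimensional_of_colength_ne_top
      (ne_top_of_two_mul_le (two_mul_colength_symIdeal_le (n := m + 2) (by omega)))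
  have : FiniteDimensional ℂ (PolyXY (m + 2) ⧸ (symIdeal (m + 2)).restrictScalars ℂ) := hfin
  obtain ⟨s, hs0, hs1, hs2, hs3⟩ := exists_equivariant_filtered_section (polyRep (m + 2))
    V hV hV0 ((symIdeal (m + 2)).restrictScalars ℂ)
    (fun g d f hf => ⟨act_mem_facetIdeal g hf.1, act_mem_degLT g hf.2⟩)
    fun g f hf => act_mem_symIdeal g hf
  simp only [polyRep_apply] at hs0
  refine ⟨TrivSqZeroExt.sndHom ℂ ℂ ∘ₗ dualEval.toLinearMap ∘ₗ s, fun f hf => ?_, fun f => ?_,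
    fun h hh => ?_⟩
  · rw [LinearMap.comp_apply, LinearMap.comp_apply, hs1 f hf, map_zero, map_zero]
  · rw [LinearMap.comp_apply, LinearMap.comp_apply, hs0]
    exact (dualEval_act_firstSwap (s f)).2
  · obtain ⟨f, hf, hfh⟩ := exists_mem_facetIdeal_tangentEval_eq hh
    obtain ⟨d, hd⟩ := exists_mem_degLT f
    obtain ⟨r, hr, hrf⟩ := exists_apply_section_eq hV hV0 hs2 hs3 tangentEval (by
      intro d f hf hfd
      obtain ⟨b, hb, hfb⟩ := exists_sub_mem_of_mem_leadIdeal
        (symIdealX_le_leadIdeal (Ideal.mem_sup_left hf)) hfd.2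
      -- The lower-degree replacement b need not be in the facet ideal, but it is so modulo
      -- `tangentIdeal m`, without raising the degree.
      obtain ⟨b', hb', hbd, hbb⟩ := exists_sub_mem_tangentIdeal d b (by
        rw [← sub_sub_cancel f b]
        exact sub_mem (Ideal.mem_sup_right hfd.1) (Ideal.mem_sup_left hfb)) hb
      refine ⟨b', ⟨hb', hbd⟩, ?_⟩
      have h1 : f - b' ∈ tangentIdeal m := by
        rw [← sub_add_sub_cancel f b b']
        exact add_mem hfb hbb
      rw [← sub_eq_zero, ← map_sub]
      funext w
      rw [tangentEval_apply, mem_tangentIdeal.mp h1]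
      rfl) d f ⟨hf, hd⟩
    refine ⟨r, hr.1, fun w => ?_⟩
    rw [LinearMap.comp_apply, LinearMap.comp_apply, hs0, ← hfh, ← hrf]
    rfl

end DualEval

/-! ### The induction on the number of points -/

lemma exists_isCoinvariantDualBasis_succ {n : ℕ} (hn : 1 ≤ n) {ℓ : Fin n → PolyXY n →ₗ[ℂ] ℂ}
    (hℓ : IsCoinvariantDualBasis n (symIdeal n) ℓ) :
    ∃ ℓ' : Fin (n + 1) → PolyXY (n + 1) →ₗ[ℂ] ℂ,
      IsCoinvariantDualBasis (n + 1) (symIdeal (n + 1)) ℓ' := by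
  obtain ⟨ℓ₁, hℓ₁⟩ := exists_functionals_vanishing_on_facetIdeal hn hℓ
  obtain ⟨m, rfl⟩ := Nat.exists_eq_add_of_le' hn
  obtain ⟨ℓ₂, hvan, hanti, hsurj⟩ := exists_functional_on_facetIdeal m
  refine ⟨Fin.snoc (α := fun _ => PolyXY (m + 2) →ₗ[ℂ] ℂ) ℓ₁ ℓ₂, ?_, ?_, ?_⟩
  · intro i f hf
    induction i using Fin.lastCases with
    | last => rw [Fin.snoc_last]; exact hvan f hf
    | cast i => rw [Fin.snoc_castSucc]; exact hℓ₁.vanish i f (Ideal.mem_sup_left hf)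
  · intro i hi f
    induction i using Fin.lastCases with
    | last => rw [Fin.snoc_last]; exact hanti f
    | cast i => rw [Fin.snoc_castSucc]; exact hℓ₁.anti i hi f
  · intro h hh
    obtain ⟨f, hf⟩ := hℓ₁.surj (fun i => h i.castSucc) fun i hi w => hh i.castSucc hi w
    -- A triangular system: f realises the prescribed values of the old functionals, and r corrects
    -- the new one. As r lies in the facet ideal, the old functionals do not see it.
    obtain ⟨r, hr, hrh⟩ := hsurj (fun w => h (Fin.last _) w - ℓ₂ (act w⁻¹ f)) fun w => by
      rw [hh (Fin.last _) (by simp), mul_inv_rev,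
        inv_eq_of_mul_eq_one_left (firstSwap_mul_self _), act_mul_apply, hanti]
      ring
    refine ⟨f + r, fun i w => ?_⟩
    rw [map_add, map_add]
    induction i using Fin.lastCases with
    | last => rw [Fin.snoc_last, hrh]; ring
    | cast i =>
      rw [Fin.snoc_castSucc, hf, hℓ₁.vanish i _ (Ideal.mem_sup_right (act_mem_facetIdeal _ hr)),
        add_zero]

theorem exists_isCoinvariantDualBasis {n : ℕ} (hn : 1 ≤ n) :
    ∃ ℓ : Fin n → PolyXY n →ₗ[ℂ] ℂ, IsCoinvariantDualBasis n (symIdeal n) ℓ := by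
  induction n, hn using Nat.le_induction with
  | base => exact ⟨_, isCoinvariantDualBasis_one⟩
  | succ n hn ih =>
    obtain ⟨ℓ, hℓ⟩ := ih
    exact exists_isCoinvariantDualBasis_succ hn hℓ

/-! ### The coinvariant algebra as a quotient of the polynomial ring -/

section Presentation

variable {n : ℕ}

/-- The presentation of the tensor power of `ℂ[x, y] / (x y)` by polynomials. -/
def polyToTPow : PolyXY n →ₐ[ℂ] TPow DoublePoint n :=
  aeval fun p => PiTensorProduct.singleAlgHom (R := ℂ) (A := fun _ => DoublePoint) p.1
    (Ideal.Quotient.mk _ (X p.2))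

lemma polyToTPow_X (i : Fin n) (b : Fin 2) : polyToTPow (X (i, b)) =
    PiTensorProduct.tprod ℂ (Pi.mulSingle i (Ideal.Quotient.mk _ (X b) : DoublePoint)) := by
  rw [polyToTPow, aeval_X]; rfl

lemma permAction_polyToTPow (σ : Equiv.Perm (Fin n)) (f : PolyXY n) :
    permAction DoublePoint n σ (polyToTPow f) = polyToTPow (act σ f) := by
  suffices h : (permAction DoublePoint n σ).comp polyToTPow = polyToTPow.comp (act σ) from
    DFunLike.congr_fun h f
  ext ⟨i, b⟩ : 1
  rw [AlgHom.comp_apply, AlgHom.comp_apply, act_X, polyToTPow_X, polyToTPow_X]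
  refine (permAlgHom_tprod DoublePoint n σ _).trans (congrArg _ (funext fun j => ?_))
  rw [Pi.mulSingle_apply, Pi.mulSingle_apply]
  simp only [Equiv.symm_apply_eq]

lemma evalOrigin_polyToTPow (f : PolyXY n) :
    evalOrigin evalZero n (polyToTPow f) = constantCoeff f := by
  have h : (evalOrigin evalZero n).comp polyToTPow =
      (aeval fun _ => (0 : ℂ) : PolyXY n →ₐ[ℂ] ℂ) := by
    ext ⟨i, b⟩ : 1
    rw [AlgHom.comp_apply, polyToTPow_X, aeval_X]
    have h1 : evalZero (Ideal.Quotient.mk _ (X b)) = 0 := by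
      change aeval (fun _ : Fin 2 => (0 : ℂ)) (X b) = 0
      rw [aeval_X]
    change PiTensorProduct.lift _ (PiTensorProduct.tprod ℂ _) = _
    rw [PiTensorProduct.lift.tprod]
    rw [MultilinearMap.compLinearMap_apply, MultilinearMap.mkPiAlgebra_apply]
    refine Finset.prod_eq_zero (Finset.mem_univ i) ?_
    rw [Pi.mulSingle_eq_same]
    exact h1
  exact (DFunLike.congr_fun h f).trans (aeval_zero' f)

lemma polyToTPow_rename (i : Fin n) (q : MvPolynomial (Fin 2) ℂ) :
    polyToTPow (rename (Prod.mk i) q) =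
      PiTensorProduct.tprod ℂ (Pi.mulSingle i (Ideal.Quotient.mk _ q : DoublePoint)) := by
  have h : polyToTPow.comp (rename (Prod.mk i)) =
      (PiTensorProduct.singleAlgHom (R := ℂ) (A := fun _ => DoublePoint) i).comp
        (Ideal.Quotient.mkₐ ℂ _) := by
    ext b : 1
    rw [AlgHom.comp_apply, rename_X, polyToTPow_X]
    rfl
  exact DFunLike.congr_fun h q

lemma polyToTPow_surjective : Function.Surjective (polyToTPow (n := n)) := by
  intro t
  induction t using PiTensorProduct.induction_on with
  | smul_tprod r f =>
    choose q hq using fun i => Ideal.Quotient.mk_surjective (f i)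
    refine ⟨r • ∏ i, rename (Prod.mk i) (q i), ?_⟩
    rw [map_smul, map_prod]
    congr 1
    simp only [polyToTPow_rename, hq]
    conv_rhs => rw [← Finset.univ_prod_mulSingle f]
    let M : (Fin n → DoublePoint) →* TPow DoublePoint n :=
      { toFun := PiTensorProduct.tprod ℂ
        map_one' := rfl
        map_mul' := fun x y => (PiTensorProduct.tprod_mul_tprod x y).symm }
    exact (map_prod M _ _).symm
  | add a b ha hb =>
    obtain ⟨f, rfl⟩ := ha
    obtain ⟨g, rfl⟩ := hb
    exact ⟨f + g, map_add _ _ _⟩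

lemma polyToTPow_X_mul_X (i : Fin n) : polyToTPow (X (i, 0) * X (i, 1)) = 0 := by
  have h := polyToTPow_rename i (X 0 * X 1)
  rw [map_mul, rename_X, rename_X] at h
  rw [h, Ideal.Quotient.eq_zero_iff_mem.mpr (Ideal.mem_span_singleton_self _)]
  exact map_zero (PiTensorProduct.singleAlgHom (R := ℂ) (A := fun _ => DoublePoint) i)

variable (n) in
/-- The map from the tensor power of `ℂ[x, y] / (x y)` to the coinvariant algebra, in terms of
polynomials. -/
def tpowToQuot : TPow DoublePoint n →ₐ[ℂ] PolyXY n ⧸ symIdeal n :=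
  PiTensorProduct.liftAlgHom
    ((MultilinearMap.mkPiAlgebra ℂ (Fin n) (PolyXY n ⧸ symIdeal n)).compLinearMap fun i =>
      (Ideal.Quotient.liftₐ _ (aeval fun b => Ideal.Quotient.mk (symIdeal n) (X (i, b))) (by
        intro a ha
        refine (Ideal.span_singleton_le_iff_mem (I := RingHom.ker
          (aeval fun b => Ideal.Quotient.mk (symIdeal n) (X (i, b)) :
            MvPolynomial (Fin 2) ℂ →ₐ[ℂ] PolyXY n ⧸ symIdeal n))).mpr ?_ ha
        rw [RingHom.mem_ker, map_mul, aeval_X, aeval_X, ← map_mul]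
        exact Ideal.Quotient.eq_zero_iff_mem.mpr (X_mul_X_mem_symIdeal i)) :
          DoublePoint →ₐ[ℂ] PolyXY n ⧸ symIdeal n).toLinearMap)
    (by simp) (by intro x y; simp [Finset.prod_mul_distrib])

lemma tpowToQuot_polyToTPow (f : PolyXY n) :
    tpowToQuot n (polyToTPow f) = Ideal.Quotient.mk (symIdeal n) f := by
  suffices h : (tpowToQuot n).comp polyToTPow = Ideal.Quotient.mkₐ ℂ (symIdeal n) from
    DFunLike.congr_fun h f
  ext ⟨i, b⟩ : 1
  rw [AlgHom.comp_apply, polyToTPow_X]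
  change PiTensorProduct.lift _ (PiTensorProduct.tprod ℂ _) = _
  rw [PiTensorProduct.lift.tprod, MultilinearMap.compLinearMap_apply,
    MultilinearMap.mkPiAlgebra_apply, Finset.prod_eq_single i]
  · rw [Pi.mulSingle_eq_same]
    change aeval _ (X b) = _
    rw [aeval_X]; rfl
  · intro j _ hj
    rw [Pi.mulSingle_eq_of_ne hj]
    exact map_one (aeval fun b => Ideal.Quotient.mk (symIdeal n) (X (j, b)) :
      MvPolynomial (Fin 2) ℂ →ₐ[ℂ] PolyXY n ⧸ symIdeal n)
  · simp

/-- Averaging any lift over the group makes it symmetric without changing its image. -/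
lemma exists_symm_polyToTPow_eq {t : TPow DoublePoint n}
    (ht : ∀ σ, permAction DoublePoint n σ t = t) :
    ∃ f : PolyXY n, (∀ σ, act σ f = f) ∧ polyToTPow f = t := by
  obtain ⟨f, rfl⟩ := polyToTPow_surjective t
  set c : ℂ := (Fintype.card (Equiv.Perm (Fin n)) : ℂ)⁻¹ with hc
  refine ⟨c • ∑ τ, act τ f, fun σ => ?_, ?_⟩
  · rw [map_smul, map_sum]
    simp only [← act_mul_apply]
    rw [← Equiv.sum_comp (Equiv.mulLeft σ) fun τ => act τ f]
    rfl
  · rw [map_smul, map_sum]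
    simp only [← permAction_polyToTPow, ht]
    rw [Finset.sum_const, Finset.card_univ, ← Nat.cast_smul_eq_nsmul ℂ, smul_smul, hc,
      inv_mul_cancel₀ (by exact_mod_cast Fintype.card_ne_zero), one_smul]

lemma polyToTPow_mem_coinvIdeal_iff {f : PolyXY n} :
    polyToTPow f ∈ coinvIdeal evalZero n ↔ f ∈ symIdeal n := by
  constructor
  · intro hf
    have hle : coinvIdeal evalZero n ≤ RingHom.ker (tpowToQuot n) := by
      refine Ideal.span_le.mpr fun t ht => ?_
      obtain ⟨g, hg, rfl⟩ := exists_symm_polyToTPow_eq ht.1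
      have h0 := ht.2
      rw [evalOrigin_polyToTPow] at h0
      change tpowToQuot n (polyToTPow g) = 0
      rw [tpowToQuot_polyToTPow]
      exact Ideal.Quotient.eq_zero_iff_mem.mpr (mem_symIdeal_of_symm hg h0)
    have := hle hf
    rw [RingHom.mem_ker, tpowToQuot_polyToTPow] at this
    exact Ideal.Quotient.eq_zero_iff_mem.mp this
  · have hle : symIdeal n ≤ (coinvIdeal evalZero n).comap polyToTPow := by
      refine symIdeal_le_iff.mpr ⟨fun i => ?_, fun g hg h0 => ?_⟩
      · rw [Ideal.mem_comap, polyToTPow_X_mul_X]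
        exact zero_mem _
      · exact Ideal.subset_span ⟨fun σ => by rw [permAction_polyToTPow, hg],
          by rw [evalOrigin_polyToTPow, h0]⟩
    exact fun hf => hle hf

variable (n) in
/-- The presentation of the coinvariant algebra by polynomials. -/
def polyToCoinv : PolyXY n →ₗ[ℂ] CoinvAlg evalZero n :=
  (Ideal.Quotient.mkₐ ℂ (coinvIdeal evalZero n)).toLinearMap ∘ₗ polyToTPow.toLinearMap

lemma polyToCoinv_surjective : Function.Surjective (polyToCoinv n) :=
  Ideal.Quotient.mk_surjective.comp polyToTPow_surjective

lemma ker_polyToCoinv :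
    LinearMap.ker (polyToCoinv n) = (symIdeal n).restrictScalars ℂ := by
  ext f
  exact Ideal.Quotient.eq_zero_iff_mem.trans polyToTPow_mem_coinvIdeal_iff

lemma coinvRep_polyToCoinv (σ : Equiv.Perm (Fin n)) (f : PolyXY n) :
    coinvRep evalZero n σ (polyToCoinv n f) = polyToCoinv n (act σ f) :=
  congrArg (Ideal.Quotient.mk (coinvIdeal evalZero n)) (permAction_polyToTPow σ f)

/-- The coinvariant algebra as a quotient of the polynomial ring. -/
def quotEquivCoinv : (PolyXY n ⧸ (symIdeal n).restrictScalars ℂ) ≃ₗ[ℂ] CoinvAlg evalZero n :=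
  (Submodule.quotEquivOfEq _ _ ker_polyToCoinv.symm).trans
    ((polyToCoinv n).quotKerEquivOfSurjective polyToCoinv_surjective)

lemma quotEquivCoinv_mk (f : PolyXY n) :
    quotEquivCoinv (Submodule.Quotient.mk f) = polyToCoinv n f := rfl

end Presentation

/-! ### The induced and regular representations as functions on the group -/

open Representation (IndV)

lemma inclS2_swap {n : ℕ} (h : 2 ≤ n) : inclS2 h (Equiv.swap 0 1) = firstSwap n := by
  have h1 : ∀ j, inclS2 h (Equiv.swap 0 1) (Fin.castLE h j) = Fin.castLE h (Equiv.swap 0 1 j) :=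
    fun j => Equiv.Perm.viaEmbedding_apply (Equiv.swap 0 1) (Fin.castLEEmb h) j
  rw [firstSwap, dif_pos h]
  refine Equiv.ext fun i => ?_
  by_cases hi : ∃ j, Fin.castLE h j = i
  · obtain ⟨j, rfl⟩ := hi
    rw [h1]
    fin_cases j
    · exact (Equiv.swap_apply_left _ _).symm
    · exact (Equiv.swap_apply_right _ _).symm
  · rw [Equiv.swap_apply_of_ne_of_ne]
    · exact Equiv.Perm.viaEmbedding_apply_of_notMem _ (Fin.castLEEmb h) _ hi
    · rintro rfl
      exact hi ⟨0, rfl⟩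
    · rintro rfl
      exact hi ⟨1, rfl⟩

section InducedRepresentation

variable {n : ℕ} (h : 2 ≤ n)

lemma indVMk_firstSwap_mul (w : Equiv.Perm (Fin n)) (a : ℂ) :
    IndV.mk (inclS2 h) signRep (firstSwap n * w) a = -IndV.mk (inclS2 h) signRep w a := by
  have h1 := Representation.Coinvariants.mk_self_apply
    (Representation.tprod ((Representation.leftRegular ℂ (Equiv.Perm (Fin n))).comp (inclS2 h))
      signRep) (Equiv.swap 0 1) (MonoidAlgebra.single w 1 ⊗ₜ a)
  rw [Representation.tprod_apply, TensorProduct.map_tmul] at h1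
  have h2 : signRep (Equiv.swap 0 1) a = -a := by simp [signRep]
  have h3 : ((Representation.leftRegular ℂ (Equiv.Perm (Fin n))).comp (inclS2 h))
      (Equiv.swap 0 1) (MonoidAlgebra.single w 1) = MonoidAlgebra.single (firstSwap n * w) 1 := by
    rw [← inclS2_swap h]
    simp
  rw [h2, h3, TensorProduct.tmul_neg, map_neg] at h1
  exact neg_eq_iff_eq_neg.mp h1

/-- The element of the induced representation with the given coefficients. -/
def funToInd : (Equiv.Perm (Fin n) → ℂ) →ₗ[ℂ] IndV (inclS2 h) signRep :=
  ∑ w, (IndV.mk (inclS2 h) signRep w⁻¹) ∘ₗ LinearMap.proj w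

lemma funToInd_apply (φ : Equiv.Perm (Fin n) → ℂ) :
    funToInd h φ = ∑ w, IndV.mk (inclS2 h) signRep w⁻¹ (φ w) := by
  simp [funToInd]

/-- In `IndV` the group acts by right multiplication with the inverse; the inverses in `funToInd`
turn this into left translation of functions. -/
lemma indSign_funToInd (g : Equiv.Perm (Fin n)) (φ : Equiv.Perm (Fin n) → ℂ) :
    indSign h g (funToInd h φ) = funToInd h fun w => φ (g⁻¹ * w) := by
  rw [funToInd_apply, funToInd_apply, map_sum,
    ← Equiv.sum_comp (Equiv.mulLeft g) fun w => IndV.mk (inclS2 h) signRep w⁻¹ (φ (g⁻¹ * w))]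
  refine Finset.sum_congr rfl fun w _ => ?_
  refine (Representation.ind_mk _ _ _ _ _).trans ?_
  simp only [Equiv.coe_mulLeft, mul_inv_rev, inv_mul_cancel_left]

lemma funToInd_mul_firstSwap (φ : Equiv.Perm (Fin n) → ℂ) :
    funToInd h (fun w => φ (w * firstSwap n)) = -funToInd h φ := by
  rw [funToInd_apply, funToInd_apply,
    ← Equiv.sum_comp (Equiv.mulRight (firstSwap n)), ← Finset.sum_neg_distrib]
  refine Finset.sum_congr rfl fun w _ => ?_
  rw [Equiv.coe_mulRight, mul_firstSwap_mul_firstSwap, mul_inv_rev,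
    inv_eq_of_mul_eq_one_left (firstSwap_mul_self n), indVMk_firstSwap_mul]

lemma funToInd_surjective : Function.Surjective (funToInd h) := by
  rw [← LinearMap.range_eq_top, ← Submodule.ker_mkQ (LinearMap.range (funToInd h)),
    LinearMap.ker_eq_top]
  refine IndV.hom_ext _ _ fun w => LinearMap.ext fun a => ?_
  rw [LinearMap.comp_apply, LinearMap.zero_comp, LinearMap.zero_apply, ← LinearMap.mem_ker,
    Submodule.ker_mkQ]
  refine ⟨Pi.single w⁻¹ a, ?_⟩
  rw [funToInd_apply, Finset.sum_eq_single w⁻¹]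
  · rw [Pi.single_eq_same, inv_inv]
  · intro v _ hv
    rw [Pi.single_eq_of_ne hv, map_zero]
  · simp

lemma exists_twisted_funToInd_eq (x : IndV (inclS2 h) signRep) :
    ∃ φ : Equiv.Perm (Fin n) → ℂ, (∀ w, φ (w * firstSwap n) = -φ w) ∧ funToInd h φ = x := by
  obtain ⟨φ, rfl⟩ := funToInd_surjective h x
  refine ⟨(2⁻¹ : ℂ) • (φ - fun w => φ (w * firstSwap n)), fun w => ?_, ?_⟩
  · simp only [Pi.smul_apply, Pi.sub_apply, mul_firstSwap_mul_firstSwap, smul_eq_mul]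
    ring
  · rw [map_smul, map_sub, funToInd_mul_firstSwap, sub_neg_eq_add, ← two_smul ℂ, smul_smul]
    norm_num

lemma finite_indV : Module.Finite ℂ (IndV (inclS2 h) signRep) :=
  Module.Finite.of_surjective _ (funToInd_surjective h)

/-- The coefficient functionals of the induced representation. -/
def indCoeff (w : Equiv.Perm (Fin n)) : IndV (inclS2 h) signRep →ₗ[ℂ] ℂ :=
  -- The difference of the coefficients at w⁻¹ and `firstSwap n` · w⁻¹ changes sign under the
  -- transposition; this cancels the sign on the second tensor factor, so the functional descends.
  Representation.Coinvariants.lift _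
    (LinearMap.mul' ℂ ℂ ∘ₗ (((Finsupp.lapply w⁻¹ - Finsupp.lapply (firstSwap n * w⁻¹)) ∘ₗ
      (MonoidAlgebra.coeffLinearEquiv ℂ).toLinearMap).rTensor ℂ)) fun σ => by
    have hσ : σ = 1 ∨ σ = Equiv.swap 0 1 := by revert σ; decide
    rcases hσ with rfl | rfl
    · rw [map_one]; rfl
    · refine TensorProduct.ext' fun x a => ?_
      have h2 : signRep (Equiv.swap 0 1) a = -a := by simp [signRep]
      have h3 : ∀ v, (Representation.leftRegular ℂ (Equiv.Perm (Fin n)) (firstSwap n) x).coeff v =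
          x.coeff (firstSwap n * v) := fun v => by
        rw [Representation.coeff_ofMulAction,
          inv_eq_of_mul_eq_one_left (firstSwap_mul_self n), smul_eq_mul]
      rw [LinearMap.comp_apply, Representation.tprod_apply, TensorProduct.map_tmul, h2,
        MonoidHom.comp_apply, inclS2_swap]
      change ((Representation.leftRegular ℂ (Equiv.Perm (Fin n)) (firstSwap n) x).coeff w⁻¹ -
        (Representation.leftRegular ℂ (Equiv.Perm (Fin n)) (firstSwap n) x).coeff
          (firstSwap n * w⁻¹)) * -a =
        (x.coeff w⁻¹ - x.coeff (firstSwap n * w⁻¹)) * a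
      rw [h3, h3, ← mul_assoc, firstSwap_mul_self, one_mul]
      ring

lemma indCoeff_mk (w v : Equiv.Perm (Fin n)) (a : ℂ) :
    indCoeff h w (IndV.mk (inclS2 h) signRep v⁻¹ a) =
      ((if w = v then 1 else 0) - if w * firstSwap n = v then 1 else 0) * a := by
  change ((Finsupp.single v⁻¹ (1 : ℂ)) w⁻¹ -
    (Finsupp.single v⁻¹ (1 : ℂ)) (firstSwap n * w⁻¹)) * a = _
  have h1 : v⁻¹ = firstSwap n * w⁻¹ ↔ w * firstSwap n = v := by
    rw [← inv_inj, inv_inv, mul_inv_rev, inv_inv,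
      inv_eq_of_mul_eq_one_left (firstSwap_mul_self n), eq_comm]
  simp only [Finsupp.single_apply, h1, inv_inj, eq_comm (a := v) (b := w)]

lemma indCoeff_funToInd (w : Equiv.Perm (Fin n)) (φ : Equiv.Perm (Fin n) → ℂ) :
    indCoeff h w (funToInd h φ) = φ w - φ (w * firstSwap n) := by
  rw [funToInd_apply, map_sum]
  simp only [indCoeff_mk, sub_mul, Finset.sum_sub_distrib, ite_mul, one_mul, zero_mul]
  simp

/-- On an anti-invariant function the coefficient functionals return twice its values, so such
functions embed in the induced representation. -/
lemma factorial_le_two_mul_finrank_indV :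
    n.factorial ≤ 2 * Module.finrank ℂ (IndV (inclS2 h) signRep) := by
  have := finite_indV h
  have hinj : Function.Injective (funToInd h ∘ₗ (twistedFunctions n (-1)).subtype) := by
    refine (injective_iff_map_eq_zero _).mpr fun φ hφ => Subtype.ext (funext fun w => ?_)
    have h1 := indCoeff_funToInd h w φ.1
    have h2 : funToInd h φ.1 = 0 := hφ
    rw [h2, map_zero, φ.2 w] at h1
    change φ.1 w = 0
    linear_combination -h1 / 2
  exact (factorial_le_two_mul_finrank_twistedFunctions h (by norm_num)).trans
    (Nat.mul_le_mul_left 2 (LinearMap.finrank_le_finrank_of_injective hinj))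

end InducedRepresentation

section RegularRepresentation

variable {n : ℕ}

/-- The element of the group algebra with the given coefficients. -/
def funEquivGroupAlgebra :
    (Equiv.Perm (Fin n) → ℂ) ≃ₗ[ℂ] MonoidAlgebra ℂ (Equiv.Perm (Fin n)) :=
  (Finsupp.linearEquivFunOnFinite ℂ ℂ (Equiv.Perm (Fin n))).symm.trans
    (MonoidAlgebra.coeffLinearEquiv ℂ).symm

lemma leftRegular_funEquivGroupAlgebra (g : Equiv.Perm (Fin n)) (φ : Equiv.Perm (Fin n) → ℂ) :
    Representation.leftRegular ℂ (Equiv.Perm (Fin n)) g (funEquivGroupAlgebra φ) =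
      funEquivGroupAlgebra fun w => φ (g⁻¹ * w) := by
  ext w
  rw [Representation.coeff_ofMulAction]
  rfl

end RegularRepresentation

/-! ### Comparison of dimensions and the equivariant surjection -/

section Comparison

variable {n : ℕ}

/-- (n + 1)! = 2 · n! + (n - 1) · n!; both sides are doubled to avoid halving factorials. -/
lemma two_mul_finrank_coinvariants_le (hn : 1 ≤ n) :
    2 * Module.finrank ℂ (PolyXY n ⧸ (symIdeal n).restrictScalars ℂ) ≤
      2 * Module.finrank ℂ (MonoidAlgebra ℂ (Equiv.Perm (Fin n)) ×
        DirectSum (Fin (n - 1)) fun i => IndV (inclS2 (two_le_of_fin i)) signRep) := by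
  have h1 : 2 * Module.finrank ℂ (PolyXY n ⧸ symIdeal n) ≤ (n + 1).factorial :=
    finrank_le_of_two_mul_colength_le (two_mul_colength_symIdeal_le hn)
  have := fun i : Fin (n - 1) => finite_indV (two_le_of_fin i)
  have : Module.Finite ℂ (MonoidAlgebra ℂ (Equiv.Perm (Fin n))) :=
    Module.Finite.equiv funEquivGroupAlgebra
  have h2 : (n - 1) * n.factorial ≤
      ∑ i : Fin (n - 1), 2 * Module.finrank ℂ (IndV (inclS2 (two_le_of_fin i)) signRep) := by
    refine le_trans ?_ (Finset.sum_le_sum fun i _ =>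
      factorial_le_two_mul_finrank_indV (two_le_of_fin i))
    simp
  rw [Module.finrank_prod, Module.finrank_directSum, ← funEquivGroupAlgebra.finrank_eq,
    Module.finrank_fintype_fun_eq_card, Fintype.card_perm, Fintype.card_fin, mul_add,
    Finset.mul_sum]
  refine h1.trans (le_trans (Eq.le ?_) (Nat.add_le_add_left h2 _))
  rw [← add_mul, Nat.factorial_succ]
  congr 1
  omega

/-- The matrix coefficients of a functional on polynomials. -/
def translates (ℓ : PolyXY n →ₗ[ℂ] ℂ) : PolyXY n →ₗ[ℂ] (Equiv.Perm (Fin n) → ℂ) :=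
  LinearMap.pi fun w => ℓ ∘ₗ (act w⁻¹).toLinearMap

lemma translates_apply (ℓ : PolyXY n →ₗ[ℂ] ℂ) (f : PolyXY n) (w : Equiv.Perm (Fin n)) :
    translates ℓ f w = ℓ (act w⁻¹ f) := rfl

lemma translates_act (ℓ : PolyXY n →ₗ[ℂ] ℂ) (g : Equiv.Perm (Fin n)) (f : PolyXY n) :
    translates ℓ (act g f) = fun w => translates ℓ f (g⁻¹ * w) := by
  funext w
  rw [translates_apply, translates_apply, mul_inv_rev, inv_inv, act_mul_apply]

/-- The map to the sum of the regular representation and the copies of the induced representation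
given by functionals on polynomials. -/
def polyToSum (ℓ₀ : PolyXY n →ₗ[ℂ] ℂ) (ℓ : Fin (n - 1) → PolyXY n →ₗ[ℂ] ℂ) :
    PolyXY n →ₗ[ℂ] MonoidAlgebra ℂ (Equiv.Perm (Fin n)) ×
      DirectSum (Fin (n - 1)) fun i => IndV (inclS2 (two_le_of_fin i)) signRep :=
  (funEquivGroupAlgebra.toLinearMap ∘ₗ translates ℓ₀).prod
    (∑ i, DirectSum.lof ℂ (Fin (n - 1))
      (fun i => IndV (inclS2 (two_le_of_fin i)) signRep) i ∘ₗ
        funToInd (two_le_of_fin i) ∘ₗ translates (ℓ i))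

lemma polyToSum_apply (ℓ₀ : PolyXY n →ₗ[ℂ] ℂ) (ℓ : Fin (n - 1) → PolyXY n →ₗ[ℂ] ℂ)
    (f : PolyXY n) : polyToSum ℓ₀ ℓ f = (funEquivGroupAlgebra (translates ℓ₀ f),
      ∑ i, DirectSum.lof ℂ (Fin (n - 1))
        (fun i => IndV (inclS2 (two_le_of_fin i)) signRep) i
          (funToInd (two_le_of_fin i) (translates (ℓ i) f))) := by
  refine Prod.ext rfl ?_
  exact LinearMap.sum_apply _ _ _

lemma polyToSum_act (ℓ₀ : PolyXY n →ₗ[ℂ] ℂ) (ℓ : Fin (n - 1) → PolyXY n →ₗ[ℂ] ℂ)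
    (g : Equiv.Perm (Fin n)) (f : PolyXY n) : polyToSum ℓ₀ ℓ (act g f) =
      (Representation.leftRegular ℂ (Equiv.Perm (Fin n))).prod (copiesIndSign n) g
        (polyToSum ℓ₀ ℓ f) := by
  rw [polyToSum_apply, polyToSum_apply]
  refine Prod.ext ?_ ?_
  · change _ = Representation.leftRegular ℂ (Equiv.Perm (Fin n)) g (funEquivGroupAlgebra _)
    rw [leftRegular_funEquivGroupAlgebra, translates_act]
  · change _ = DirectSum.lmap (fun i => indSign (two_le_of_fin i) g) (∑ i : Fin (n - 1), _)
    rw [map_sum]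
    dsimp only
    refine Finset.sum_congr rfl fun i _ => ?_
    rw [DirectSum.lmap_lof, indSign_funToInd, translates_act]

/-- Every element of the induced representation comes from an anti-invariant function, and `hℓ.surj`
prescribes all these functions simultaneously with an arbitrary one for the regular summand. -/
lemma polyToSum_surjective (hn : 1 ≤ n) {ℓ : Fin n → PolyXY n →ₗ[ℂ] ℂ}
    (hℓ : IsCoinvariantDualBasis n (symIdeal n) ℓ) : Function.Surjective
      (polyToSum (ℓ ⟨0, hn⟩) fun i : Fin (n - 1) => ℓ ⟨i + 1, by omega⟩) := by
  rintro ⟨a, b⟩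
  choose φ hφ hφb using fun i => exists_twisted_funToInd_eq (two_le_of_fin i) (b i)
  obtain ⟨f, hf⟩ := hℓ.surj (fun i => if hi : (i : ℕ) = 0 then funEquivGroupAlgebra.symm a else
      φ ⟨i - 1, by omega⟩) fun i hi w => by
    simp only [dif_neg hi]
    exact hφ _ w
  refine ⟨f, ?_⟩
  rw [polyToSum_apply]
  refine Prod.ext ?_ ?_
  · change funEquivGroupAlgebra _ = a
    rw [← LinearEquiv.eq_symm_apply]
    funext w
    rw [translates_apply, hf]
    simp
  · refine Eq.trans ?_ (DirectSum.sum_univ_of b)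
    dsimp only
    refine Finset.sum_congr rfl fun i _ => ?_
    rw [← hφb i]
    refine congrArg (fun ψ => DirectSum.lof ℂ (Fin (n - 1))
        (fun i => IndV (inclS2 (two_le_of_fin i)) signRep) i
          (funToInd (two_le_of_fin i) ψ)) (funext fun w => ?_)
    rw [translates_apply, hf]
    simp

end Comparison

end SymCoinv

theorem theorem1 (n : ℕ) (hn : 1 ≤ n) :
    Nonempty ((SymCoinv.coinvRep SymCoinv.evalZero n).Equiv
      ((Representation.leftRegular ℂ (Equiv.Perm (Fin n))).prod
        (SymCoinv.copiesIndSign n))) := by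
  obtain ⟨ℓ, hℓ⟩ := SymCoinv.exists_isCoinvariantDualBasis hn
  set E := SymCoinv.polyToSum (ℓ ⟨0, hn⟩) fun i : Fin (n - 1) => ℓ ⟨i + 1, by omega⟩ with hE
  have hker : (SymCoinv.symIdeal n).restrictScalars ℂ ≤ LinearMap.ker E := fun f hf => by
    have h0 : ∀ i, SymCoinv.translates (ℓ i) f = 0 := fun i =>
      funext fun w => hℓ.vanish i _ (SymCoinv.act_mem_symIdeal w⁻¹ hf)
    rw [LinearMap.mem_ker, hE, SymCoinv.polyToSum_apply]
    simp [h0]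
  set Q := ((SymCoinv.symIdeal n).restrictScalars ℂ).liftQ E hker with hQ
  have hsurj : Function.Surjective Q := fun x => by
    obtain ⟨f, rfl⟩ := SymCoinv.polyToSum_surjective hn hℓ x
    exact ⟨Submodule.Quotient.mk f, rfl⟩
  have hfin : FiniteDimensional ℂ (SymCoinv.PolyXY n ⧸ SymCoinv.symIdeal n) :=
    SymCoinv.finiteDimensional_of_colength_ne_top
      (SymCoinv.ne_top_of_two_mul_le (SymCoinv.two_mul_colength_symIdeal_le hn))
  have : FiniteDimensional ℂ
      (SymCoinv.PolyXY n ⧸ (SymCoinv.symIdeal n).restrictScalars ℂ) := hfin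
  -- A surjection onto a space of at least the same finite dimension has trivial kernel.
  have hinj : Function.Injective Q := by
    have h1 := SymCoinv.two_mul_finrank_coinvariants_le hn
    have h2 := Q.finrank_range_add_finrank_ker
    rw [LinearMap.range_eq_top.mpr hsurj, finrank_top] at h2
    rw [← LinearMap.ker_eq_bot, ← Submodule.finrank_eq_zero (R := ℂ)]
    omega
  refine ⟨Representation.Equiv.mk
    (SymCoinv.quotEquivCoinv.symm.trans (LinearEquiv.ofBijective Q ⟨hinj, hsurj⟩)) fun g => ?_⟩
  refine LinearMap.ext fun x => ?_
  obtain ⟨f, rfl⟩ := SymCoinv.polyToCoinv_surjective x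
  have h1 : ∀ f, (SymCoinv.quotEquivCoinv.symm.trans (LinearEquiv.ofBijective Q ⟨hinj, hsurj⟩))
      (SymCoinv.polyToCoinv n f) = E f := fun f => by
    rw [← SymCoinv.quotEquivCoinv_mk, LinearEquiv.trans_apply, LinearEquiv.symm_apply_apply]
    rfl
  change (SymCoinv.quotEquivCoinv.symm.trans (LinearEquiv.ofBijective Q ⟨hinj, hsurj⟩))
    (SymCoinv.coinvRep SymCoinv.evalZero n g (SymCoinv.polyToCoinv n f)) = _
  rw [SymCoinv.coinvRep_polyToCoinv, h1]
  refine (SymCoinv.polyToSum_act _ _ g f).trans (congrArg _ (h1 f).symm)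

end
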